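/- Let $K$ be a field of characteristic $0$ and $\mathbb N^*=\{1,2,\dots\}$. A composition of length $n$ is $J=(j_1,\dots,j_n)\in(\mathbb N^*)^n$, with weight $|J|=j_1+\cdots+j_n$. For compositions $I,J$ of the same length and weight $N$, let $c_{IJ}$ be the number of set partitions of $\{1,\dots,N\}$ whose blocks, ordered by increasing maxima, have sizes $i_1,\dots,i_n$ and maxima $j_1,\ j_1+j_2,\ \dots,\ j_1+\cdots+j_n$. Let $\mathbf{FQSym}^{(\mathbb N^*)}$ be the $K$-algebra with linear basis $\mathbf F_{\sigma,c}$ ($n\ge 0$, $\sigma\in\mathfrak S_n$, $c\in(\mathbb N^*)^n$) and product $\mathbf F_{\sigma',c'}\mathbf F_{\sigma'',c''}=\sum\mathbf F_{\sigma,c}$, where, for $\sigma'\in\mathfrak S_m$, the sum is over all coloured permutations $(\sigma,c)$, regarded as words of coloured letters $(\sigma_1,c_1)\cdots(\sigma_n,c_n)$, that occur in the shuffle of the word of $(\sigma',c')$ with the word of $(\sigma'',c'')$ whose letters $\sigma''_i$ have been replaced by $\sigma''_i+m$. For $\sigma\in\mathfrak S_n$, $J\in(\mathbb N^*)^n$ and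 $m\ge 0$ put $\epsilon_{\sigma[m],J}=0^{j_1-1}(\sigma_1+m)\,0^{j_2-1}(\sigma_2+m)\cdots 0^{j_n-1}(\sigma_n+m)$ and $\epsilon_{\sigma,J}=\epsilon_{\sigma[0],J}$. Write $\langle w\mid u \mathbin{\sqcup\!\sqcup} v\rangle$ for the multiplicity of the word $w$ in the shuffle of the words $u$ and $v$. **Theorem.** (1) For every composition $J$ of length $n$, $$\sum_{|I|=|J|,\ \ell(I)=n}c_{IJ}\prod_{s=1}^n x_s^{i_s-1}=\prod_{s=1}^n(x_s+\cdots+x_n)^{j_s-1}.$$ Moreover $c_{II}=1$, and $c_{IJ}\neq0$ implies $I\le J$ lexicographically. (2) There is exactly one family $(\mathbf Z_{\sigma,J})$ in $\mathbf{FQSym}^{(\mathbb N^*)}$ such that $\mathbf F_{\sigma,I}=\sum_{|J|=|I|,\ \ell(J)=n}c_{IJ}\,\mathbf Z_{\sigma,J}$ for all $n$, $\sigma\in\mathfrak S_n$ and $I\in(\mathbb N^*)^n$, and it is a linear basis of $\mathbf{FQSym}^{(\mathbb N^*)}$. (3) For $\sigma'\in\mathfrak S_m$, $J'\in(\mathbb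 N^*)^m$, $\sigma''\in\mathfrak S_n$, $J''\in(\mathbb N^*)^n$, $$\mathbf Z_{\sigma',J'}\,\mathbf Z_{\sigma'',J''}=\sum_{\sigma\in\mathfrak S_{m+n}}\ \sum_{J}\ \langle\epsilon_{\sigma,J}\mid\epsilon_{\sigma',J'} \mathbin{\sqcup\!\sqcup} \epsilon_{\sigma''[m],J''}\rangle\,\mathbf Z_{\sigma,J},$$ where $J$ runs over the compositions of length $m+n$ and weight $|J'|+|J''|$. (4) For $\sigma\in\mathfrak S_n$ and $s\in(\mathbb N^*)^n$ let $$z_{\sigma,s}(u_1,\dots,u_n)=\frac1{u_{\sigma(1)}^{s_1}(u_{\sigma(1)}+u_{\sigma(2)})^{s_2}\cdots(u_{\sigma(1)}+\cdots+u_{\sigma(n)})^{s_n}}\in K(u_1,\dots,u_n),$$ and let $\bar z_{\sigma,s}$ be the fraction obtained by reversing both words $\sigma$ and $s$, that is, $$\bar z_{\sigma,s}=z_{\sigma_n\cdots\sigma_1,(s_n,\dots,s_1)}=\prod_{i=1}^n\bigl(u_{\sigma(i)}+\cdots+u_{\sigma(n)}\bigr)^{-s_i}.$$ Then, for $\sigma',J',\sigma'',J''$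 and the range of summation as in (3), $$\bar z_{\sigma',J'}(u_1,\dots,u_m)\,\bar z_{\sigma'',J''}(u_{m+1},\dots,u_{m+n})=\sum_{\sigma,J}\langle\epsilon_{\sigma,J}\mid\epsilon_{\sigma',J'} \mathbin{\sqcup\!\sqcup} \epsilon_{\sigma''[m],J''}\rangle\,\bar z_{\sigma,J}(u_1,\dots,u_{m+n}).$$ Consequently, in the $K$-algebra $\bigoplus_{n\ge0}K(u_1,\dots,u_n)$ of rational moulds, with product extending $f_m*g_n=f_m(u_1,\dots,u_m)\,g_n(u_{m+1},\dots,u_{m+n})$ bilinearly, there is an injective $K$-algebra homomorphism from $\mathbf{FQSym}^{(\mathbb N^*)}$ which maps $\mathbf Z_{\sigma,J}$ to $\bar z_{\sigma,J}$ for all $\sigma$ and $J$, and whose image is the linear span of all the fractions $z_{\sigma,s}$. -/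

import Mathlib

/-! ### Compositions of given length, and the set-partition coefficients -/

/-- The weight `|J| = j₁ + ⋯ + jₙ` of a composition `J = (j₁, …, jₙ)` of length `n`. -/
def compWeight {n : ℕ} (J : Fin n → ℕ+) : ℕ := ∑ i, (J i : ℕ)

/-- The finite set of all compositions of `N` of length `n`. -/
def compsOf (n N : ℕ) : Finset (Fin n → ℕ+) :=
  (Fintype.piFinset fun _ => Finset.Icc 1 N.succPNat).filter fun J => compWeight J = N

theorem mem_compsOf {n N : ℕ} {J : Fin n → ℕ+} : J ∈ compsOf n N ↔ compWeight J = N := by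
  unfold compsOf
  simp only [Finset.mem_filter, Fintype.mem_piFinset, Finset.mem_Icc, and_iff_right_iff_imp]
  intro h i
  refine ⟨one_le, ?_⟩
  rw [← PNat.coe_le_coe, Nat.succPNat_coe, ← h]
  exact (Finset.single_le_sum (f := fun i => (J i : ℕ)) (fun _ _ => Nat.zero_le _)
    (Finset.mem_univ i)).trans (Nat.le_succ _)

/-- The increasing list of the maxima of the blocks of a set partition of `{1, …, N}`. -/
def blockMaxima {N : ℕ} (P : Finpartition (Finset.Icc 1 N)) : List ℕ :=
  (P.parts.image fun B => B.sup id).sort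

/-- `K(π)`: the list of the block sizes, the blocks being ordered by increasing maxima. -/
def blockSizes {N : ℕ} (P : Finpartition (Finset.Icc 1 N)) : List ℕ :=
  (blockMaxima P).map fun m => (P.part m).card

/-- `C(π)`: the composition of `N` whose partial sums are the maxima of the blocks. -/
def maximaSteps {N : ℕ} (P : Finpartition (Finset.Icc 1 N)) : List ℕ :=
  List.zipWith (fun m m' => m - m') (blockMaxima P) (0 :: blockMaxima P)

/-- `c_{IJ}`: the number of set partitions `π` of `{1, …, |I|}` with `K(π) = I` and
`C(π) = J`. -/
def setPartCoeff {n : ℕ} (I J : Fin n → ℕ+) : ℕ :=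
  (Finset.univ.filter fun P : Finpartition (Finset.Icc 1 (compWeight I)) =>
    blockSizes P = List.ofFn (fun s => (I s : ℕ)) ∧
    maximaSteps P = List.ofFn (fun s => (J s : ℕ))).card

/-! ### Shuffles of words -/

/-- The shuffle of two words, as a multiset of words; the coefficient `⟨w | u ⧢ v⟩` is
`(shuffle u v).count w`. -/
def shuffle {α : Type*} : List α → List α → Multiset (List α)
  | [], v => {v}
  | a :: u, [] => {a :: u}
  | a :: u, b :: v =>
    (shuffle u (b :: v)).map (List.cons a) + (shuffle (a :: u) v).map (List.cons b)
termination_by u v => u.length + v.length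

/-- The word of coloured letters `(σ₁ + m, c₁) ⋯ (σₙ + m, cₙ)`, with `σᵢ ∈ {1, …, n}`: the
coloured permutation `(σ, c)` with its letters shifted by `m`. -/
def colWord (m : ℕ) {n : ℕ} (σ : Equiv.Perm (Fin n)) (c : Fin n → ℕ+) : List (ℕ × ℕ+) :=
  List.ofFn fun i => ((σ i : ℕ) + 1 + m, c i)

/-- The word `0^{j₁-1} (σ₁ + m) 0^{j₂-1} (σ₂ + m) ⋯ 0^{jₙ-1} (σₙ + m)`, with
`σᵢ ∈ {1, …, n}`: this is `ε_{σ,J}` for `m = 0`, and `ε_{σ[m],J}` in general. -/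
def epsWord (m : ℕ) {n : ℕ} (σ : Equiv.Perm (Fin n)) (J : Fin n → ℕ+) : List ℕ :=
  (List.ofFn fun i => List.replicate ((J i : ℕ) - 1) 0 ++ [(σ i : ℕ) + 1 + m]).flatten

/-! ### Free quasi-symmetric functions coloured by positive integers -/

/-- Coloured permutations: pairs `(σ, c)` with `σ ∈ 𝔖ₙ` and `c` a word of `n` positive
integers, for all `n ≥ 0`. -/
abbrev ColPerm : Type := Σ n : ℕ, Equiv.Perm (Fin n) × (Fin n → ℕ+)

/-- The underlying vector space of `FQSym^{(ℕ*)}`: the free vector space on the coloured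
permutations. -/
def FQSymCol (K : Type*) [Field K] : Type _ := ColPerm →₀ K

namespace FQSymCol

variable (K : Type*) [Field K]

noncomputable instance : AddCommGroup (FQSymCol K) := inferInstanceAs (AddCommGroup (ColPerm →₀ K))

noncomputable instance : Module K (FQSymCol K) := inferInstanceAs (Module K (ColPerm →₀ K))

/-- The basis element `F_{σ,c}`. -/
noncomputable def F {n : ℕ} (σ : Equiv.Perm (Fin n)) (c : Fin n → ℕ+) : FQSymCol K :=
  (Finsupp.single ⟨n, σ, c⟩ 1 : ColPerm →₀ K)

/-- The product `F_{σ',c'} F_{σ'',c''}`: the sum of the `F_{σ,c}` over the shifted shuffle of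
the coloured permutations `(σ', c')` and `(σ'', c'')`. -/
noncomputable def basisMul (a b : ColPerm) : FQSymCol K :=
  ∑ σ : Equiv.Perm (Fin (a.1 + b.1)),
    ∑ c ∈ compsOf (a.1 + b.1) (compWeight a.2.2 + compWeight b.2.2),
      (((shuffle (colWord 0 a.2.1 a.2.2) (colWord a.1 b.2.1 b.2.2)).count
        (colWord 0 σ c) : ℕ) : K) • F K σ c

/-- The bilinear extension of the product of the basis elements. -/
noncomputable def mulHom : FQSymCol K →ₗ[K] FQSymCol K →ₗ[K] FQSymCol K :=
  (Finsupp.linearCombination K fun a : ColPerm =>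
    (Finsupp.linearCombination K fun b : ColPerm => basisMul K a b :
      (ColPerm →₀ K) →ₗ[K] FQSymCol K) : (ColPerm →₀ K) →ₗ[K] _)

noncomputable instance : Mul (FQSymCol K) := ⟨fun x y => mulHom K x y⟩

/-- The unit is `F_{∅,∅}`, indexed by the empty coloured permutation. -/
noncomputable instance : One (FQSymCol K) := ⟨F K (1 : Equiv.Perm (Fin 0)) ![]⟩

end FQSymCol

/-! ### The algebra structure of `FQSym^{(ℕ*)}` -/

theorem shuffle_nil_left {α : Type*} (v : List α) : shuffle [] v = {v} := by
  rw [shuffle]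

theorem shuffle_nil_right {α : Type*} (u : List α) : shuffle u [] = {u} := by
  cases u <;> rw [shuffle]

theorem shuffle_cons_cons {α : Type*} (a b : α) (u v : List α) :
    shuffle (a :: u) (b :: v) =
      (shuffle u (b :: v)).map (List.cons a) + (shuffle (a :: u) v).map (List.cons b) := by
  rw [shuffle]

theorem perm_of_mem_shuffle {α : Type*} : ∀ (u v w : List α), w ∈ shuffle u v → w.Perm (u ++ v)
  | [], v, w, h => by
    rw [shuffle_nil_left, Multiset.mem_singleton] at h
    simp [h]
  | a :: u, [], w, h => by
    rw [shuffle_nil_right, Multiset.mem_singleton] at h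
    simp [h]
  | a :: u, b :: v, w, h => by
    rw [shuffle_cons_cons, Multiset.mem_add, Multiset.mem_map, Multiset.mem_map] at h
    rcases h with ⟨x, hx, rfl⟩ | ⟨x, hx, rfl⟩
    · exact (perm_of_mem_shuffle u (b :: v) x hx).cons a
    · exact ((perm_of_mem_shuffle (a :: u) v x hx).cons b).trans List.perm_middle.symm
termination_by u v => u.length + v.length

theorem shuffle_map {α β : Type*} (f : α → β) : ∀ u v : List α,
    shuffle (u.map f) (v.map f) = (shuffle u v).map (List.map f)
  | [], v => by simp [shuffle_nil_left]
  | a :: u, [] => by simp [shuffle_nil_right]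
  | a :: u, b :: v => by
    have h1 := shuffle_map f u (b :: v)
    have h2 := shuffle_map f (a :: u) v
    simp only [List.map_cons] at h1 h2 ⊢
    rw [shuffle_cons_cons, shuffle_cons_cons, h1, h2]
    simp [Multiset.map_map]
termination_by u v => u.length + v.length

theorem shuffle_assoc {α : Type*} : ∀ u v w : List α,
    (shuffle u v).bind (fun x => shuffle x w) = (shuffle v w).bind (fun x => shuffle u x)
  | [], v, w => by
    simp only [shuffle_nil_left, Multiset.singleton_bind]
    exact ((Multiset.bind_singleton _ id).trans (Multiset.map_id _)).symm
  | a :: u, [], w => by simp [shuffle_nil_left, shuffle_nil_right]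
  | a :: u, b :: v, [] => by
    simp only [shuffle_nil_right, Multiset.singleton_bind]
    exact (Multiset.bind_singleton _ id).trans (Multiset.map_id _)
  | a :: u, b :: v, c :: w => by
    have h1 := shuffle_assoc u (b :: v) (c :: w)
    have h2 := shuffle_assoc (a :: u) v (c :: w)
    have h3 := shuffle_assoc (a :: u) (b :: v) w
    have hl : (shuffle (a :: u) (b :: v)).bind (fun x => shuffle x (c :: w)) =
        ((shuffle u (b :: v)).bind fun x => shuffle x (c :: w)).map (List.cons a) +
        ((shuffle (a :: u) v).bind fun x => shuffle x (c :: w)).map (List.cons b) +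
        ((shuffle (a :: u) (b :: v)).bind fun x => shuffle x w).map (List.cons c) := by
      rw [shuffle_cons_cons a b u v]
      simp only [Multiset.add_bind, Multiset.bind_map, shuffle_cons_cons, Multiset.bind_add,
        Multiset.map_bind, Multiset.map_add]
      abel
    have hr : (shuffle (b :: v) (c :: w)).bind (fun x => shuffle (a :: u) x) =
        ((shuffle (b :: v) (c :: w)).bind fun x => shuffle u x).map (List.cons a) +
        ((shuffle v (c :: w)).bind fun x => shuffle (a :: u) x).map (List.cons b) +
        ((shuffle (b :: v) w).bind fun x => shuffle (a :: u) x).map (List.cons c) := by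
      rw [shuffle_cons_cons b c v w]
      simp only [Multiset.add_bind, Multiset.bind_map, shuffle_cons_cons, Multiset.bind_add,
        Multiset.map_bind, Multiset.map_add]
      abel
    rw [hl, hr, h1, h2, h3]
termination_by u v w => u.length + v.length + w.length

/-- The coloured letter `(a, c)` shifted to `(a + m, c)`. -/
def shiftLetter (m : ℕ) (x : ℕ × ℕ+) : ℕ × ℕ+ := (x.1 + m, x.2)

theorem colWord_eq_map {n : ℕ} (m : ℕ) (σ : Equiv.Perm (Fin n)) (c : Fin n → ℕ+) :
    colWord m σ c = (colWord 0 σ c).map (shiftLetter m) := by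
  simp [colWord, List.map_ofFn, Function.comp_def, shiftLetter]

theorem length_colWord {n : ℕ} (m : ℕ) (σ : Equiv.Perm (Fin n)) (c : Fin n → ℕ+) :
    (colWord m σ c).length = n := by
  simp [colWord]

theorem colWord_injective : Function.Injective fun a : ColPerm => colWord 0 a.2.1 a.2.2 := by
  rintro ⟨n, σ, c⟩ ⟨m, τ, d⟩ h
  have hn : n = m := by
    simpa [length_colWord] using congrArg List.length h
  subst hn
  have h' := List.ofFn_injective h
  have hσ : σ = τ := by
    ext i
    have := congrArg Prod.fst (congrFun h' i)
    simpa using this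
  have hc : c = d := funext fun i => congrArg Prod.snd (congrFun h' i)
  rw [hσ, hc]

theorem exists_colWord_eq {n : ℕ} (w : List (ℕ × ℕ+))
    (hw : (w.map Prod.fst).Perm ((List.range n).map (· + 1))) :
    ∃ (σ : Equiv.Perm (Fin n)) (c : Fin n → ℕ+), colWord 0 σ c = w := by
  have hlen : w.length = n := by simpa using hw.length_eq
  subst hlen
  have hmem : ∀ i : Fin w.length, ∃ k < w.length, k + 1 = (w.get i).1 := by
    intro i
    have : (w.get i).1 ∈ (List.range w.length).map (· + 1) :=
      hw.mem_iff.1 (List.mem_map_of_mem (List.get_mem w i))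
    simpa using this
  choose f hf hf' using hmem
  have hnd : (w.map Prod.fst).Nodup :=
    hw.nodup_iff.2 (List.nodup_range.map (fun a b h => by simpa using h))
  have hinj : Function.Injective fun i : Fin w.length => (⟨f i, hf i⟩ : Fin w.length) := by
    intro i j hij
    have h1 : f i = f j := by simpa using hij
    have h2 : (w.get i).1 = (w.get j).1 := by rw [← hf' i, ← hf' j, h1]
    have h3 := List.nodup_iff_injective_get.1 hnd
    have h4 := @h3 ⟨i, by simp⟩ ⟨j, by simp⟩ (by simpa using h2)
    exact Fin.ext (by simpa using h4)
  refine ⟨Equiv.ofBijective _ (Finite.injective_iff_bijective.1 hinj), fun i => (w.get i).2, ?_⟩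
  unfold colWord
  apply List.ext_getElem (by simp)
  intro k h1 h2
  have h3 : f ⟨k, h2⟩ + 1 = w[k].1 := hf' ⟨k, h2⟩
  simp only [List.getElem_ofFn, Equiv.ofBijective_apply, add_zero, h3]
  rfl

theorem perm_map_fst_colWord {n : ℕ} (m : ℕ) (σ : Equiv.Perm (Fin n)) (c : Fin n → ℕ+) :
    ((colWord m σ c).map Prod.fst).Perm ((List.range n).map (· + 1 + m)) := by
  have h : (colWord m σ c).map Prod.fst =
      ((List.ofFn fun i : Fin n => σ i).map fun i : Fin n => (i : ℕ) + 1 + m) := by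
    simp [colWord, List.map_ofFn, Function.comp_def]
  have h2 : (List.range n).map (· + 1 + m) =
      (List.finRange n).map fun i : Fin n => (i : ℕ) + 1 + m := by
    rw [← List.map_coe_finRange_eq_range, List.map_map]
    rfl
  rw [h, h2]
  refine List.Perm.map _ ?_
  rw [← List.ofFn_id]
  exact Equiv.Perm.ofFn_comp_perm σ (id : Fin n → Fin n)

theorem sum_map_snd_colWord {n : ℕ} (m : ℕ) (σ : Equiv.Perm (Fin n)) (c : Fin n → ℕ+) :
    ((colWord m σ c).map fun x => (x.2 : ℕ)).sum = compWeight c := by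
  simp [colWord, List.map_ofFn, Function.comp_def, compWeight, List.sum_ofFn]

/-- Every word in the shifted shuffle of two coloured permutations is a coloured permutation. -/
theorem mem_shuffle_colWord (a b : ColPerm) (w : List (ℕ × ℕ+))
    (hw : w ∈ shuffle (colWord 0 a.2.1 a.2.2) (colWord a.1 b.2.1 b.2.2)) :
    ∃ (σ : Equiv.Perm (Fin (a.1 + b.1))) (c : Fin (a.1 + b.1) → ℕ+),
      compWeight c = compWeight a.2.2 + compWeight b.2.2 ∧ colWord 0 σ c = w := by
  have hp := perm_of_mem_shuffle _ _ _ hw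
  have h1 : (w.map Prod.fst).Perm ((List.range (a.1 + b.1)).map (· + 1)) := by
    refine (hp.map Prod.fst).trans ?_
    rw [List.map_append, List.range_add, List.map_append]
    refine (perm_map_fst_colWord _ _ _).append ((perm_map_fst_colWord _ _ _).trans ?_)
    rw [List.map_map]
    refine List.Perm.of_eq (List.map_congr_left fun x _ => ?_)
    simp only [Function.comp_apply]
    omega
  obtain ⟨σ, c, h⟩ := exists_colWord_eq w h1
  refine ⟨σ, c, ?_, h⟩
  have h2 := (hp.map fun x => (x.2 : ℕ)).sum_eq
  rw [List.map_append, List.sum_append, sum_map_snd_colWord, sum_map_snd_colWord, ← h,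
    sum_map_snd_colWord] at h2
  exact h2

section WordAlgebra

variable (K : Type*) [Field K]

/-- The sum of the words of a multiset. -/
noncomputable def wordSum (s : Multiset (List (ℕ × ℕ+))) : List (ℕ × ℕ+) →₀ K :=
  (s.map fun w => Finsupp.single w 1).sum

/-- The shifted shuffle product on the linear span of all coloured words. -/
noncomputable def wordMul :
    (List (ℕ × ℕ+) →₀ K) →ₗ[K] (List (ℕ × ℕ+) →₀ K) →ₗ[K] (List (ℕ × ℕ+) →₀ K) :=
  Finsupp.linearCombination K fun u =>
    Finsupp.linearCombination K fun v => wordSum K (shuffle u (v.map (shiftLetter u.length)))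

theorem wordMul_single (u v : List (ℕ × ℕ+)) :
    wordMul K (Finsupp.single u 1) (Finsupp.single v 1) =
      wordSum K (shuffle u (v.map (shiftLetter u.length))) := by
  simp [wordMul]

theorem wordMul_wordSum_left (s : Multiset (List (ℕ × ℕ+))) (w : List (ℕ × ℕ+)) :
    wordMul K (wordSum K s) (Finsupp.single w 1) =
      wordSum K (s.bind fun u => shuffle u (w.map (shiftLetter u.length))) := by
  induction s using Multiset.induction_on with
  | empty => simp [wordSum]
  | cons a s ih =>
    have h : wordSum K (a ::ₘ s) = Finsupp.single a 1 + wordSum K s := by simp [wordSum]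
    rw [h, map_add, LinearMap.add_apply, ih, wordMul_single, Multiset.cons_bind]
    simp [wordSum]

theorem wordMul_wordSum_right (s : Multiset (List (ℕ × ℕ+))) (u : List (ℕ × ℕ+)) :
    wordMul K (Finsupp.single u 1) (wordSum K s) =
      wordSum K (s.bind fun w => shuffle u (w.map (shiftLetter u.length))) := by
  induction s using Multiset.induction_on with
  | empty => simp [wordSum]
  | cons a s ih =>
    have h : wordSum K (a ::ₘ s) = Finsupp.single a 1 + wordSum K s := by simp [wordSum]
    rw [h, map_add, ih, wordMul_single, Multiset.cons_bind]
    simp [wordSum]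

theorem wordMul_assoc (x y z : List (ℕ × ℕ+) →₀ K) :
    wordMul K (wordMul K x y) z = wordMul K x (wordMul K y z) := by
  induction x using Finsupp.induction_linear with
  | zero => simp
  | add x x' h h' => simp [h, h']
  | single u r =>
  induction y using Finsupp.induction_linear with
  | zero => simp
  | add x x' h h' => simp [h, h']
  | single v s =>
  induction z using Finsupp.induction_linear with
  | zero => simp
  | add x x' h h' => simp [h, h']
  | single w t =>
    rw [← mul_one r, ← mul_one s, ← mul_one t, ← smul_eq_mul, ← smul_eq_mul, ← smul_eq_mul,
      ← Finsupp.smul_single, ← Finsupp.smul_single, ← Finsupp.smul_single]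
    simp only [map_smul, LinearMap.smul_apply]
    congr 3
    rw [wordMul_single, wordMul_single, wordMul_wordSum_left, wordMul_wordSum_right]
    congr 1
    have h1 : (shuffle v (w.map (shiftLetter v.length))).bind
          (fun x => shuffle u (x.map (shiftLetter u.length))) =
        ((shuffle v (w.map (shiftLetter v.length))).map (List.map (shiftLetter u.length))).bind
          (fun x => shuffle u x) := by rw [Multiset.bind_map]
    rw [h1, ← shuffle_map, ← shuffle_assoc]
    refine Multiset.bind_congr fun x hx => ?_
    have := (perm_of_mem_shuffle _ _ _ hx).length_eq
    rw [List.map_map, this]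
    congr 2
    funext y
    simp only [shiftLetter, Function.comp_apply, List.length_append, List.length_map]
    rw [add_assoc, add_comm v.length]

end WordAlgebra

namespace FQSymCol

variable (K : Type*) [Field K]

/-- The linear embedding into the space of coloured words. -/
noncomputable def toWords : FQSymCol K →ₗ[K] (List (ℕ × ℕ+) →₀ K) :=
  Finsupp.lmapDomain K K fun a : ColPerm => colWord 0 a.2.1 a.2.2

theorem toWords_injective : Function.Injective (toWords K) :=
  Finsupp.mapDomain_injective colWord_injective

theorem toWords_F {n : ℕ} (σ : Equiv.Perm (Fin n)) (c : Fin n → ℕ+) :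
    toWords K (F K σ c) = Finsupp.single (colWord 0 σ c) 1 :=
  Finsupp.mapDomain_single

theorem toWords_basisMul (a b : ColPerm) :
    toWords K (basisMul K a b) =
      wordSum K (shuffle (colWord 0 a.2.1 a.2.2) (colWord a.1 b.2.1 b.2.2)) := by
  classical
  unfold basisMul wordSum
  set s := shuffle (colWord 0 a.2.1 a.2.2) (colWord a.1 b.2.1 b.2.2) with hs
  simp only [map_sum, map_smul, toWords_F]
  have himg := Finset.sum_image (s := (Finset.univ : Finset (Equiv.Perm (Fin (a.1 + b.1)))) ×ˢ
      compsOf (a.1 + b.1) (compWeight a.2.2 + compWeight b.2.2))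
      (g := fun x => colWord 0 x.1 x.2)
      (f := fun w => ((s.count w : ℕ) : K) • (Finsupp.single w 1 : List (ℕ × ℕ+) →₀ K)) ?_
  · rw [Finset.sum_multiset_map_count, ← Finset.sum_product', ← himg]
    symm
    simp only [Nat.cast_smul_eq_nsmul]
    refine Finset.sum_subset ?_ ?_
    · intro w hw
      rw [Multiset.mem_toFinset] at hw
      obtain ⟨σ, c, hc, h⟩ := mem_shuffle_colWord a b w hw
      exact Finset.mem_image.2 ⟨(σ, c), by simp [mem_compsOf, hc], h⟩
    · intro w _ hw
      rw [Multiset.mem_toFinset] at hw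
      rw [Multiset.count_eq_zero_of_notMem hw, zero_smul]
  · rintro ⟨σ, c⟩ _ ⟨τ, d⟩ _ h
    have := @colWord_injective ⟨_, σ, c⟩ ⟨_, τ, d⟩ h
    simpa using this

theorem F_mul_F {m n : ℕ} (σ : Equiv.Perm (Fin m)) (c : Fin m → ℕ+)
    (τ : Equiv.Perm (Fin n)) (d : Fin n → ℕ+) :
    F K σ c * F K τ d = basisMul K ⟨m, σ, c⟩ ⟨n, τ, d⟩ := by
  change mulHom K (F K σ c) (F K τ d) = _
  unfold mulHom F
  erw [Finsupp.linearCombination_single, one_smul, Finsupp.linearCombination_single, one_smul]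

theorem induction_linear {p : FQSymCol K → Prop} (x : FQSymCol K) (zero : p 0)
    (add : ∀ x y, p x → p y → p (x + y))
    (smul_F : ∀ (r : K) (n : ℕ) (σ : Equiv.Perm (Fin n)) (c : Fin n → ℕ+), p (r • F K σ c)) :
    p x := by
  refine Finsupp.induction_linear (motive := p) x zero add ?_
  rintro ⟨n, σ, c⟩ r
  have h : (Finsupp.single ⟨n, σ, c⟩ r : ColPerm →₀ K) = r • Finsupp.single ⟨n, σ, c⟩ 1 := by
    rw [Finsupp.smul_single, smul_eq_mul, mul_one]
  rw [h]
  exact smul_F r n σ c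

theorem mul_def (x y : FQSymCol K) : x * y = mulHom K x y := rfl

theorem toWords_mul (x y : FQSymCol K) :
    toWords K (x * y) = wordMul K (toWords K x) (toWords K y) := by
  rw [mul_def]
  induction x using induction_linear with
  | zero => simp
  | add x x' h h' => simp [h, h']
  | smul_F r m σ c =>
  induction y using induction_linear with
  | zero => simp
  | add x x' h h' => rw [map_add, map_add, map_add, map_add, h, h']
  | smul_F s n τ d =>
    simp only [map_smul, LinearMap.smul_apply]
    congr 2
    rw [← mul_def, F_mul_F, toWords_basisMul, toWords_F, toWords_F, wordMul_single,
      length_colWord, ← colWord_eq_map]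

theorem toWords_one : toWords K 1 = Finsupp.single [] 1 := by
  change toWords K (F K (1 : Equiv.Perm (Fin 0)) ![]) = _
  rw [toWords_F]
  simp [colWord]

noncomputable instance : Ring (FQSymCol K) where
  __ := (inferInstance : AddCommGroup (FQSymCol K))
  mul_assoc x y z := toWords_injective K (by simp only [toWords_mul, wordMul_assoc])
  left_distrib x y z := by simp only [mul_def, map_add]
  right_distrib x y z := by simp only [mul_def, map_add, LinearMap.add_apply]
  zero_mul x := by simp only [mul_def, map_zero, LinearMap.zero_apply]
  mul_zero x := by simp only [mul_def, map_zero]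
  one_mul x := by
    refine toWords_injective K ?_
    rw [toWords_mul, toWords_one]
    induction toWords K x using Finsupp.induction_linear with
    | zero => simp
    | add x y h h' => rw [map_add, h, h']
    | single u r =>
      have hs : shiftLetter 0 = id := rfl
      simp [wordMul, shuffle_nil_left, wordSum, hs]
  mul_one x := by
    refine toWords_injective K ?_
    rw [toWords_mul, toWords_one]
    induction toWords K x using Finsupp.induction_linear with
    | zero => simp
    | add x y h h' => rw [map_add, LinearMap.add_apply, h, h']
    | single u r => simp [wordMul, shuffle_nil_right, wordSum]
  zsmul := (inferInstance : AddCommGroup (FQSymCol K)).zsmul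

noncomputable instance : Algebra K (FQSymCol K) :=
  Algebra.ofModule (fun r x y => by simp only [mul_def, map_smul, LinearMap.smul_apply])
    (fun r x y => by simp only [mul_def, map_smul])

end FQSymCol

/-! ### Rational moulds -/

/-- The field `K(u₁, …, uₙ)` of rational functions in `n` variables. -/
abbrev RatFn (K : Type*) [Field K] (n : ℕ) : Type _ := FractionRing (MvPolynomial (Fin n) K)

namespace RatFn

variable (K : Type*) [Field K]

/-- The variable `uᵢ` as a rational function. -/
noncomputable def var {n : ℕ} (i : Fin n) : RatFn K n :=
  algebraMap (MvPolynomial (Fin n) K) (RatFn K n) (MvPolynomial.X i)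

/-- The substitution `f(u₁, …, uₚ) ↦ f(u_{e(1)}, …, u_{e(p)})` along an injection `e`. -/
noncomputable def subst {p n : ℕ} (e : Fin p ↪ Fin n) : RatFn K p →+* RatFn K n :=
  IsFractionRing.map (j := (MvPolynomial.rename (R := K) e).toRingHom)
    (MvPolynomial.rename_injective e e.injective)

/-- `mu(f, g) = f(u₁, …, uₘ) g(u_{m+1}, …, u_{m+n})`. -/
noncomputable def mu {m n : ℕ} (f : RatFn K m) (g : RatFn K n) : RatFn K (m + n) :=
  subst K (Fin.castAddEmb n) f * subst K (Fin.natAddEmb m) g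

/-- The fraction `z_{σ,s}`, that is, the inverse of
`u_{σ(1)}^{s₁} (u_{σ(1)} + u_{σ(2)})^{s₂} ⋯ (u_{σ(1)} + ⋯ + u_{σ(n)})^{sₙ}`. -/
noncomputable def zFrac {n : ℕ} (σ : Equiv.Perm (Fin n)) (s : Fin n → ℕ+) : RatFn K n :=
  (∏ i, (∑ k ∈ Finset.Iic i, var K (σ k)) ^ (s i : ℕ))⁻¹

theorem subst_algebraMap {p n : ℕ} (e : Fin p ↪ Fin n) (f : MvPolynomial (Fin p) K) :
    subst K e (algebraMap _ (RatFn K p) f) =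
      algebraMap _ (RatFn K n) (MvPolynomial.rename e f) := by
  unfold subst IsFractionRing.map
  rw [IsLocalization.map_eq]
  rfl

theorem ringHom_ext {p : ℕ} {L : Type*} [Field L] {f g : RatFn K p →+* L}
    (h : ∀ q : MvPolynomial (Fin p) K, f (algebraMap _ _ q) = g (algebraMap _ _ q)) : f = g :=
  IsLocalization.ringHom_ext (nonZeroDivisors (MvPolynomial (Fin p) K)) (RingHom.ext h)

theorem subst_subst {p q n : ℕ} (e : Fin p ↪ Fin q) (e' : Fin q ↪ Fin n) (f : RatFn K p) :
    subst K e' (subst K e f) = subst K (e.trans e') f := by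
  have h : (subst K e').comp (subst K e) = subst K (e.trans e') := by
    refine ringHom_ext K fun q => ?_
    simp only [RingHom.comp_apply, subst_algebraMap, MvPolynomial.rename_rename]
    rfl
  exact DFunLike.congr_fun h f

theorem subst_refl {p : ℕ} (f : RatFn K p) : subst K (Function.Embedding.refl _) f = f := by
  have h : subst K (Function.Embedding.refl _) = RingHom.id (RatFn K p) := by
    refine ringHom_ext K fun q => ?_
    rw [subst_algebraMap]
    exact congrArg _ (MvPolynomial.rename_id_apply q)
  exact DFunLike.congr_fun h f

theorem algebraMap_eq {p : ℕ} (r : K) :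
    algebraMap K (RatFn K p) r =
      algebraMap (MvPolynomial (Fin p) K) (RatFn K p) (MvPolynomial.C r) :=
  IsScalarTower.algebraMap_apply K (MvPolynomial (Fin p) K) (RatFn K p) r

theorem subst_const {p n : ℕ} (e : Fin p ↪ Fin n) (r : K) :
    subst K e (algebraMap K _ r) = algebraMap K _ r := by
  rw [algebraMap_eq, subst_algebraMap, MvPolynomial.rename_C, ← algebraMap_eq]

/-- Equality of homogeneous moulds whose numbers of variables are equal but not
definitionally so. -/
theorem mk_eq_mk {p n : ℕ} (h : p = n) (f : RatFn K p) (g : RatFn K n)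
    (hfg : subst K (finCongr h).toEmbedding f = g) :
    GradedMonoid.mk (A := RatFn K) p f = GradedMonoid.mk n g := by
  subst h
  have : subst K (finCongr (rfl : p = p)).toEmbedding f = f := subst_refl K f
  rw [← hfg, this]

theorem subst_congr {p n : ℕ} {e e' : Fin p ↪ Fin n} (h : ∀ i, (e i : ℕ) = e' i)
    (f : RatFn K p) : subst K e f = subst K e' f := by
  rw [show e = e' from Function.Embedding.ext fun i => Fin.ext (h i)]

theorem subst_eq_self {p : ℕ} {e : Fin p ↪ Fin p} (h : ∀ i, (e i : ℕ) = i)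
    (f : RatFn K p) : subst K e f = f :=
  (subst_congr K (e' := Function.Embedding.refl _) h f).trans (subst_refl K f)

theorem subst_mu {m n p : ℕ} (e : Fin (m + n) ↪ Fin p) (f : RatFn K m) (g : RatFn K n) :
    subst K e (mu K f g) = subst K ((Fin.castAddEmb n).trans e) f *
      subst K ((Fin.natAddEmb m).trans e) g := by
  unfold mu
  rw [map_mul, subst_subst, subst_subst]

theorem mu_assoc {m n p : ℕ} (f : RatFn K m) (g : RatFn K n) (h : RatFn K p) :
    subst K (finCongr (add_assoc m n p)).toEmbedding (mu K (mu K f g) h) =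
      mu K f (mu K g h) := by
  rw [subst_mu, subst_mu, mul_assoc]
  conv_rhs => rw [mu, subst_mu]
  refine congrArg₂ _ (subst_congr K (fun i => ?_) f)
    (congrArg₂ _ (subst_congr K (fun i => ?_) g) (subst_congr K (fun i => ?_) h))
  · simp
  · simp
  · simp [add_assoc]

theorem mu_const_left {n m : ℕ} (h : 0 + n = m) (r : K) (f : RatFn K n) :
    subst K (finCongr h).toEmbedding (mu K (algebraMap K (RatFn K 0) r) f) =
      algebraMap K _ r * subst K (finCongr ((zero_add n).symm.trans h)).toEmbedding f := by
  rw [subst_mu, subst_const]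
  exact congrArg _ (subst_congr K (fun i => by simp) f)

theorem mu_const_right {n m : ℕ} (h : n + 0 = m) (r : K) (f : RatFn K n) :
    subst K (finCongr h).toEmbedding (mu K f (algebraMap K (RatFn K 0) r)) =
      algebraMap K _ r * subst K (finCongr ((add_zero n).symm.trans h)).toEmbedding f := by
  rw [subst_mu, subst_const, mul_comm]
  exact congrArg _ (subst_congr K (fun i => rfl) f)

noncomputable instance : GradedMonoid.GMul (RatFn K) where
  mul := mu K

noncomputable instance : GradedMonoid.GOne (RatFn K) where
  one := 1

noncomputable instance : DirectSum.GSemiring (RatFn K) where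
  mul_zero a := show mu K a 0 = 0 by simp only [mu, map_zero, mul_zero]
  zero_mul a := show mu K 0 a = 0 by simp only [mu, map_zero, zero_mul]
  mul_add a b c := show mu K a (b + c) = mu K a b + mu K a c by
    simp only [mu, map_add, mul_add]
  add_mul a b c := show mu K (a + b) c = mu K a c + mu K b c by
    simp only [mu, map_add, add_mul]
  one_mul := by
    rintro ⟨n, f⟩
    refine mk_eq_mk K (zero_add n) (mu K 1 f) f ?_
    rw [← map_one (algebraMap K (RatFn K 0)), mu_const_left, map_one, one_mul]
    exact subst_eq_self K (fun i => by simp) f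
  mul_one := by
    rintro ⟨n, f⟩
    refine mk_eq_mk K (add_zero n) (mu K f 1) f ?_
    rw [← map_one (algebraMap K (RatFn K 0)), mu_const_right, map_one, one_mul]
    exact subst_eq_self K (fun i => by simp) f
  mul_assoc := by
    rintro ⟨m, f⟩ ⟨n, g⟩ ⟨p, h⟩
    exact mk_eq_mk K (add_assoc m n p) (mu K (mu K f g) h) (mu K f (mu K g h)) (mu_assoc K f g h)
  natCast n := n
  natCast_zero := Nat.cast_zero
  natCast_succ n := Nat.cast_succ n

noncomputable instance : DirectSum.GAlgebra K (RatFn K) where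
  toFun := (algebraMap K (RatFn K 0)).toAddMonoidHom
  map_one := map_one (algebraMap K (RatFn K 0))
  map_mul r s := by
    refine (mk_eq_mk K (zero_add 0) (mu K (algebraMap K _ r) (algebraMap K _ s))
      (algebraMap K (RatFn K 0) (r * s)) ?_).symm
    rw [mu_const_left, subst_const, map_mul]
  commutes := by
    rintro r ⟨n, f⟩
    refine (mk_eq_mk K (zero_add n) (mu K (algebraMap K _ r) f) (algebraMap K _ r * f) ?_).trans
      (mk_eq_mk K (add_zero n) (mu K f (algebraMap K _ r)) (algebraMap K _ r * f) ?_).symm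
    · rw [mu_const_left]
      exact congrArg _ (subst_eq_self K (fun i => by simp) f)
    · rw [mu_const_right]
      exact congrArg _ (subst_eq_self K (fun i => by simp) f)
  smul_def := by
    rintro r ⟨n, f⟩
    refine (mk_eq_mk K (zero_add n) (mu K (algebraMap K _ r) f) (r • f) ?_).symm
    rw [mu_const_left, Algebra.smul_def]
    exact congrArg _ (subst_eq_self K (fun i => by simp) f)

end RatFn

/-- The algebra of rational moulds: finite sums `f = ∑ₙ fₙ(u₁, …, uₙ)` of homogeneous moulds,
with the product that extends `mu` bilinearly. -/
abbrev RatMould (K : Type*) [Field K] : Type _ := DirectSum ℕ (RatFn K)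

/-! ### Set partitions with prescribed block maxima -/

section BlockMax

variable {N : ℕ}

/-- The maximum of the block of `e`. -/
def blockMax (P : Finpartition (Finset.Icc 1 N)) (e : ℕ) : ℕ := (P.part e).sup id

/-- The set of the maxima of the blocks. -/
def maxSet (P : Finpartition (Finset.Icc 1 N)) : Finset ℕ := P.parts.image fun B => B.sup id

theorem blockMax_mem_part (P : Finpartition (Finset.Icc 1 N)) {e : ℕ} (he : e ∈ Finset.Icc 1 N) :
    blockMax P e ∈ P.part e := by
  obtain ⟨i, hi, h⟩ := Finset.exists_mem_eq_sup (P.part e) (P.part_nonempty.2 he) id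
  rw [blockMax, h]
  exact hi

theorem blockMax_mem (P : Finpartition (Finset.Icc 1 N)) {e : ℕ} (he : e ∈ Finset.Icc 1 N) :
    blockMax P e ∈ Finset.Icc 1 N :=
  P.part_subset e (blockMax_mem_part P he)

theorem part_blockMax (P : Finpartition (Finset.Icc 1 N)) {e : ℕ} (he : e ∈ Finset.Icc 1 N) :
    P.part (blockMax P e) = P.part e :=
  (P.mem_part_iff_part_eq_part (blockMax_mem P he) he).1 (blockMax_mem_part P he)

theorem le_blockMax (P : Finpartition (Finset.Icc 1 N)) {e : ℕ} (he : e ∈ Finset.Icc 1 N) :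
    e ≤ blockMax P e :=
  Finset.le_sup (f := id) (P.mem_part_self.2 he)

theorem blockMax_eq_iff (P : Finpartition (Finset.Icc 1 N)) {e e' : ℕ}
    (he : e ∈ Finset.Icc 1 N) (he' : e' ∈ Finset.Icc 1 N) :
    blockMax P e = blockMax P e' ↔ P.part e = P.part e' := by
  refine ⟨fun h => ?_, fun h => by rw [blockMax, h, blockMax]⟩
  rw [← part_blockMax P he, h, part_blockMax P he']

theorem mem_part_iff_blockMax (P : Finpartition (Finset.Icc 1 N)) {e e' : ℕ}
    (he' : e' ∈ Finset.Icc 1 N) :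
    e ∈ P.part e' ↔ e ∈ Finset.Icc 1 N ∧ blockMax P e = blockMax P e' := by
  constructor
  · intro h
    have he := P.part_subset e' h
    exact ⟨he, (blockMax_eq_iff P he he').2 ((P.mem_part_iff_part_eq_part he he').1 h)⟩
  · rintro ⟨he, h⟩
    exact (P.mem_part_iff_part_eq_part he he').2 ((blockMax_eq_iff P he he').1 h)

theorem mem_maxSet (P : Finpartition (Finset.Icc 1 N)) {d : ℕ} :
    d ∈ maxSet P ↔ d ∈ Finset.Icc 1 N ∧ blockMax P d = d := by
  unfold maxSet
  simp only [Finset.mem_image]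
  constructor
  · rintro ⟨B, hB, rfl⟩
    obtain ⟨e, he⟩ := P.nonempty_of_mem_parts hB
    have heN := P.subset hB he
    have hB' : P.part e = B := P.part_eq_of_mem hB he
    have : B.sup id = blockMax P e := by rw [blockMax, hB']
    rw [this]
    refine ⟨blockMax_mem P heN, ?_⟩
    rw [blockMax, part_blockMax P heN, blockMax]
  · rintro ⟨hd, h⟩
    exact ⟨P.part d, P.part_mem.2 hd, h⟩

theorem blockMax_mem_maxSet (P : Finpartition (Finset.Icc 1 N)) {e : ℕ}
    (he : e ∈ Finset.Icc 1 N) : blockMax P e ∈ maxSet P :=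
  Finset.mem_image.2 ⟨P.part e, P.part_mem.2 he, rfl⟩

theorem eq_of_blockMax_eq {P Q : Finpartition (Finset.Icc 1 N)}
    (h : ∀ e ∈ Finset.Icc 1 N, blockMax P e = blockMax Q e) : P = Q := by
  have hp : ∀ e ∈ Finset.Icc 1 N, P.part e = Q.part e := by
    intro e he
    ext a
    rw [mem_part_iff_blockMax P he, mem_part_iff_blockMax Q he]
    refine and_congr_right fun ha => ?_
    rw [h a ha, h e he]
  have key : ∀ P Q : Finpartition (Finset.Icc 1 N),
      (∀ e ∈ Finset.Icc 1 N, P.part e = Q.part e) → P.parts ⊆ Q.parts := by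
    intro P Q hp B hB
    obtain ⟨e, he⟩ := P.nonempty_of_mem_parts hB
    have heN := P.subset hB he
    rw [← P.part_eq_of_mem hB he, hp e heN]
    exact Q.part_mem.2 heN
  exact Finpartition.ext (Finset.Subset.antisymm (key P Q hp)
    (key Q P fun e he => (hp e he).symm))

theorem exists_blockMax_eq {D : Finset ℕ} (hD : D ⊆ Finset.Icc 1 N) (g : ℕ → ℕ)
    (hgD : ∀ e ∈ Finset.Icc 1 N, g e ∈ D) (hge : ∀ e ∈ Finset.Icc 1 N, e ≤ g e)
    (hgd : ∀ d ∈ D, g d = d) :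
    ∃ P : Finpartition (Finset.Icc 1 N), maxSet P = D ∧
      ∀ e ∈ Finset.Icc 1 N, blockMax P e = g e := by
  classical
  let P := Finpartition.ofSetSetoid (Setoid.ker g) (Finset.Icc 1 N)
  have hpart : ∀ e ∈ Finset.Icc 1 N, ∀ a, a ∈ P.part e ↔ a ∈ Finset.Icc 1 N ∧ g a = g e := by
    intro e he a
    by_cases ha : a ∈ Finset.Icc 1 N
    · have := Finpartition.mem_part_ofSetSetoid_iff_rel (s := Setoid.ker g) (Finset.Icc 1 N)
        (a := e) (b := a)
      rw [this]
      simp only [Setoid.ker_def]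
      tauto
    · exact ⟨fun h => absurd (P.part_subset e h) ha, fun h => absurd h.1 ha⟩
  have hmax : ∀ e ∈ Finset.Icc 1 N, blockMax P e = g e := by
    intro e he
    refine le_antisymm (Finset.sup_le fun a ha => ?_) ?_
    · obtain ⟨haN, h⟩ := (hpart e he a).1 ha
      rw [← h]
      exact hge a haN
    · exact Finset.le_sup (f := id)
        ((hpart e he (g e)).2 ⟨hD (hgD e he), hgd _ (hgD e he)⟩)
  refine ⟨P, ?_, hmax⟩
  ext d
  rw [mem_maxSet]
  constructor
  · rintro ⟨hd, h⟩
    rw [← h, hmax d hd]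
    exact hgD d hd
  · intro hd
    exact ⟨hD hd, by rw [hmax d (hD hd), hgd d hd]⟩

/-- The generating function of the set partitions with prescribed set of block maxima. -/
theorem sum_prod_blockMax {R : Type*} [CommSemiring R] {D : Finset ℕ}
    (hD : D ⊆ Finset.Icc 1 N) (y : ℕ → R) :
    ∑ P : Finpartition (Finset.Icc 1 N) with maxSet P = D, ∏ e ∈ Finset.Icc 1 N, y (blockMax P e) =
      ∏ e ∈ Finset.Icc 1 N, ∑ b ∈ if e ∈ D then {e} else D.filter (e ≤ ·), y b := by
  classical
  rw [Finset.prod_sum]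
  refine Finset.sum_bij (fun P _ => fun e _ => blockMax P e) ?_ ?_ ?_ ?_
  · intro P hP
    obtain rfl : maxSet P = D := by simpa using hP
    refine Finset.mem_pi.2 fun e he => ?_
    split_ifs with h
    · rw [Finset.mem_singleton]
      exact ((mem_maxSet P).1 h).2
    · exact Finset.mem_filter.2 ⟨blockMax_mem_maxSet P he, le_blockMax P he⟩
  · intro P _ Q _ h
    exact eq_of_blockMax_eq fun e he => congrFun (congrFun h e) he
  · intro p hp
    have hp' : ∀ e (he : e ∈ Finset.Icc 1 N), p e he ∈ D ∧ e ≤ p e he ∧ (e ∈ D → p e he = e) := by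
      intro e he
      have := Finset.mem_pi.1 hp e he
      split_ifs at this with h
      · rw [Finset.mem_singleton] at this
        rw [this]
        exact ⟨h, le_rfl, fun _ => rfl⟩
      · rw [Finset.mem_filter] at this
        exact ⟨this.1, this.2, fun h' => absurd h' h⟩
    obtain ⟨P, hP, hPg⟩ := exists_blockMax_eq hD
      (fun e => if he : e ∈ Finset.Icc 1 N then p e he else 0)
      (fun e he => by simpa only [dif_pos he] using (hp' e he).1)
      (fun e he => by simpa only [dif_pos he] using (hp' e he).2.1)
      (fun d hd => by simpa only [dif_pos (hD hd)] using (hp' d (hD hd)).2.2 hd)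
    refine ⟨P, by simpa using hP, ?_⟩
    funext e he
    rw [hPg e he, dif_pos he]
  · intro P _
    exact (Finset.prod_attach _ (fun e => y (blockMax P e))).symm

end BlockMax

/-! ### The generating function of the set-partition coefficients -/

section FinSums

variable {M : Type*} [CommMonoid M] {n : ℕ}

@[to_additive]
theorem prod_Iic_zero_fin (f : Fin (n + 1) → M) : ∏ t ∈ Finset.Iic 0, f t = f 0 := by
  rw [show Finset.Iic (0 : Fin (n + 1)) = {0} by ext i; simp, Finset.prod_singleton]

@[to_additive]
theorem prod_Iic_succ_fin (f : Fin (n + 1) → M) (s : Fin n) :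
    ∏ t ∈ Finset.Iic s.succ, f t = f 0 * ∏ t ∈ Finset.Iic s, f t.succ := by
  rw [← Finset.filter_ge_eq_Iic, ← Finset.filter_ge_eq_Iic, Finset.prod_filter,
    Finset.prod_filter, Fin.prod_univ_succ]
  simp

@[to_additive]
theorem prod_Iio_zero_fin (f : Fin (n + 1) → M) : ∏ t ∈ Finset.Iio 0, f t = 1 := by
  rw [show Finset.Iio (0 : Fin (n + 1)) = ∅ by ext i; simp, Finset.prod_empty]

@[to_additive]
theorem prod_Iio_succ_fin (f : Fin (n + 1) → M) (s : Fin n) :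
    ∏ t ∈ Finset.Iio s.succ, f t = f 0 * ∏ t ∈ Finset.Iio s, f t.succ := by
  rw [← Finset.filter_gt_eq_Iio, ← Finset.filter_gt_eq_Iio, Finset.prod_filter,
    Finset.prod_filter, Fin.prod_univ_succ]
  simp

@[to_additive]
theorem prod_Ici_zero_fin (f : Fin (n + 1) → M) : ∏ t ∈ Finset.Ici 0, f t = ∏ t, f t := by
  rw [show Finset.Ici (0 : Fin (n + 1)) = Finset.univ by ext i; simp]

@[to_additive]
theorem prod_Ici_succ_fin (f : Fin (n + 1) → M) (s : Fin n) :
    ∏ t ∈ Finset.Ici s.succ, f t = ∏ t ∈ Finset.Ici s, f t.succ := by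
  rw [← Finset.filter_le_eq_Ici, ← Finset.filter_le_eq_Ici, Finset.prod_filter,
    Finset.prod_filter, Fin.prod_univ_succ]
  simp

end FinSums

section PartialSums

/-- The partial sums of a list of natural numbers, starting from `a` (excluded). -/
def partialSums : ℕ → List ℕ → List ℕ
  | _, [] => []
  | a, j :: js => (a + j) :: partialSums (a + j) js

theorem zipWith_sub_partialSums (a : ℕ) (js : List ℕ) :
    List.zipWith (fun m m' => m - m') (partialSums a js) (a :: partialSums a js) = js := by
  induction js generalizing a with
  | nil => rfl
  | cons j js ih => simp [partialSums, ih]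

theorem eq_partialSums_of_zipWith_sub {a : ℕ} {l js : List ℕ} (hl : (a :: l).IsChain (· ≤ ·))
    (h : List.zipWith (fun m m' => m - m') l (a :: l) = js) : l = partialSums a js := by
  induction l generalizing a js with
  | nil => subst h; rfl
  | cons b l ih =>
    rw [List.isChain_cons_cons] at hl
    subst h
    have hb : a + (b - a) = b := by omega
    simp only [List.zipWith_cons_cons, partialSums, hb]
    exact congrArg _ (ih hl.2 rfl)

theorem partialSums_ofFn (a : ℕ) {n : ℕ} (J : Fin n → ℕ) :
    partialSums a (List.ofFn J) = List.ofFn fun s => a + ∑ t ∈ Finset.Iic s, J t := by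
  induction n generalizing a with
  | zero => simp [partialSums]
  | succ n ih =>
    rw [List.ofFn_succ, List.ofFn_succ, partialSums, ih]
    simp only [sum_Iic_zero_fin, sum_Iic_succ_fin, add_assoc]

theorem prod_Ioc_add_sum {M : Type*} [CommMonoid M] (h : ℕ → M) (a : ℕ) {n : ℕ} (J : Fin n → ℕ) :
    ∏ e ∈ Finset.Ioc a (a + ∑ s, J s), h e =
      ∏ s, ∏ e ∈ Finset.Ioc (a + ∑ t ∈ Finset.Iio s, J t) (a + ∑ t ∈ Finset.Iic s, J t), h e := by
  induction n generalizing a with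
  | zero => simp
  | succ n ih =>
    rw [Fin.prod_univ_succ, Fin.sum_univ_succ, ← Finset.prod_Ioc_consecutive h
      (Nat.le_add_right a (J 0)) (by omega : a + J 0 ≤ a + (J 0 + ∑ i : Fin n, J i.succ)),
      ← add_assoc, ih]
    simp only [sum_Iic_zero_fin, sum_Iic_succ_fin, sum_Iio_zero_fin, sum_Iio_succ_fin, add_assoc,
      add_zero]

end PartialSums

section GeneratingFunction

variable {n : ℕ}

/-- The partial sums `j₁ + ⋯ + j_s` of a composition. -/
def partialSum (J : Fin n → ℕ+) (s : Fin n) : ℕ := ∑ t ∈ Finset.Iic s, (J t : ℕ)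

theorem partialSum_eq (J : Fin n → ℕ+) (s : Fin n) :
    partialSum J s = ∑ t ∈ Finset.Iio s, (J t : ℕ) + J s := by
  rw [partialSum, ← Finset.Iio_insert, Finset.sum_insert (by simp), add_comm]

theorem partialSum_le_sum_Iio (J : Fin n → ℕ+) {s t : Fin n} (h : s < t) :
    partialSum J s ≤ ∑ t ∈ Finset.Iio t, (J t : ℕ) :=
  Finset.sum_le_sum_of_subset fun i hi => by
    rw [Finset.mem_Iic] at hi
    exact Finset.mem_Iio.2 (hi.trans_lt h)

theorem partialSum_strictMono (J : Fin n → ℕ+) : StrictMono (partialSum J) := by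
  intro s t h
  have := partialSum_le_sum_Iio J h
  have h2 := partialSum_eq J t
  have := (J t).pos
  omega

theorem partialSum_mem (J : Fin n → ℕ+) (s : Fin n) :
    partialSum J s ∈ Finset.Icc 1 (compWeight J) := by
  rw [Finset.mem_Icc]
  constructor
  · have := partialSum_eq J s
    have := (J s).pos
    omega
  · exact Finset.sum_le_sum_of_subset (Finset.subset_univ _)

theorem blockMaxima_eq {N : ℕ} (P : Finpartition (Finset.Icc 1 N)) :
    blockMaxima P = (maxSet P).sort := rfl

theorem sort_image_partialSum (J : Fin n → ℕ+) :
    (Finset.univ.image (partialSum J)).sort = List.ofFn (partialSum J) := by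
  refine (List.Perm.eq_of_pairwise' (r := (· ≤ ·)) (Finset.pairwise_sort _ _) ?_ ?_)
  · exact (List.sortedLE_ofFn_iff.2 (partialSum_strictMono J).monotone).pairwise
  · rw [List.perm_ext_iff_of_nodup (Finset.sort_nodup _ _)
      (List.nodup_ofFn.2 (partialSum_strictMono J).injective)]
    intro a
    simp

theorem maximaSteps_eq_iff {N : ℕ} (P : Finpartition (Finset.Icc 1 N)) (J : Fin n → ℕ+) :
    maximaSteps P = List.ofFn (fun s => (J s : ℕ)) ↔
      maxSet P = Finset.univ.image (partialSum J) := by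
  have hps : partialSums 0 (List.ofFn fun s => (J s : ℕ)) = List.ofFn (partialSum J) := by
    rw [partialSums_ofFn]
    simp only [zero_add]
    rfl
  constructor
  · intro h
    have hc : (0 :: blockMaxima P).IsChain (· ≤ ·) := by
      have := (Finset.pairwise_sort (maxSet P) (· ≤ ·))
      exact (List.pairwise_cons.2 ⟨fun _ _ => Nat.zero_le _, this⟩).isChain
    have h1 := eq_partialSums_of_zipWith_sub hc h
    rw [hps, blockMaxima_eq] at h1
    have h2 := congrArg List.toFinset h1
    rw [Finset.sort_toFinset] at h2
    rw [h2]
    ext a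
    simp
  · intro h
    rw [maximaSteps, blockMaxima_eq, h, sort_image_partialSum, ← hps, zipWith_sub_partialSums]

theorem blockSizes_eq {N : ℕ} {P : Finpartition (Finset.Icc 1 N)} {J : Fin n → ℕ+}
    (h : maxSet P = Finset.univ.image (partialSum J)) :
    blockSizes P = List.ofFn fun s => (P.part (partialSum J s)).card := by
  rw [blockSizes, blockMaxima_eq, h, sort_image_partialSum, List.map_ofFn]
  rfl

theorem image_blockMax {N : ℕ} (P : Finpartition (Finset.Icc 1 N)) :
    (Finset.Icc 1 N).image (blockMax P) = maxSet P := by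
  ext d
  rw [Finset.mem_image]
  constructor
  · rintro ⟨e, he, rfl⟩
    exact blockMax_mem_maxSet P he
  · intro hd
    exact ⟨d, (mem_maxSet P).1 hd⟩

theorem filter_blockMax_eq {N : ℕ} (P : Finpartition (Finset.Icc 1 N)) {d : ℕ}
    (hd : d ∈ maxSet P) : (Finset.Icc 1 N).filter (fun e => blockMax P e = d) = P.part d := by
  obtain ⟨h1, h2⟩ := (mem_maxSet P).1 hd
  ext e
  rw [Finset.mem_filter, mem_part_iff_blockMax P h1, h2]

theorem prod_blockMax {M : Type*} [CommMonoid M] {N : ℕ} {P : Finpartition (Finset.Icc 1 N)}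
    {J : Fin n → ℕ+} (h : maxSet P = Finset.univ.image (partialSum J)) (y : ℕ → M) :
    ∏ e ∈ Finset.Icc 1 N, y (blockMax P e) =
      ∏ s, y (partialSum J s) ^ (P.part (partialSum J s)).card := by
  rw [Finset.prod_comp y (blockMax P), image_blockMax, h,
    Finset.prod_image ((partialSum_strictMono J).injective.injOn)]
  refine Finset.prod_congr rfl fun s _ => ?_
  rw [filter_blockMax_eq]
  rw [h]
  exact Finset.mem_image_of_mem _ (Finset.mem_univ s)

theorem sum_card_part {N : ℕ} {P : Finpartition (Finset.Icc 1 N)} {J : Fin n → ℕ+}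
    (h : maxSet P = Finset.univ.image (partialSum J)) :
    ∑ s, (P.part (partialSum J s)).card = N := by
  have := prod_blockMax h (fun _ => Multiplicative.ofAdd 1)
  simp only [← ofAdd_nsmul, ← ofAdd_sum, smul_eq_mul, mul_one, Finset.sum_const] at this
  simpa using (Multiplicative.ofAdd.injective this).symm

theorem prod_sum_allowed {R : Type*} [CommSemiring R] (J : Fin n → ℕ+) (y : ℕ → R) :
    (∏ e ∈ Finset.Icc 1 (compWeight J),
      ∑ b ∈ if e ∈ Finset.univ.image (partialSum J) then {e}
        else (Finset.univ.image (partialSum J)).filter (e ≤ ·), y b) =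
      ∏ s, y (partialSum J s) *
        (∑ t ∈ Finset.Ici s, y (partialSum J t)) ^ ((J s : ℕ) - 1) := by
  have h := prod_Ioc_add_sum (fun e => ∑ b ∈ if e ∈ Finset.univ.image (partialSum J) then {e}
        else (Finset.univ.image (partialSum J)).filter (e ≤ ·), y b) 0 (fun s => (J s : ℕ))
  simp only [zero_add] at h
  rw [show Finset.Icc 1 (compWeight J) = Finset.Ioc 0 (∑ s, (J s : ℕ)) from rfl, h]
  refine Finset.prod_congr rfl fun s _ => ?_
  change ∏ e ∈ Finset.Ioc _ (partialSum J s), _ = _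
  have hlt : ∑ t ∈ Finset.Iio s, (J t : ℕ) < partialSum J s := by
    have := partialSum_eq J s
    have := (J s).pos
    omega
  rw [← Finset.Ioo_insert_right hlt, Finset.prod_insert (by simp)]
  congr 1
  · simp
  · rw [Finset.prod_congr rfl (g := fun _ => ∑ t ∈ Finset.Ici s, y (partialSum J t)),
      Finset.prod_const, Nat.card_Ioo]
    · have := partialSum_eq J s
      congr 1
      omega
    · intro e he
      rw [Finset.mem_Ioo] at he
      have hiff : ∀ t, e ≤ partialSum J t ↔ s ≤ t := by
        intro t
        constructor
        · intro het
          by_contra hts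
          have := partialSum_le_sum_Iio J (not_le.1 hts)
          omega
        · intro hst
          have := (partialSum_strictMono J).monotone hst
          omega
      have hne : e ∉ Finset.univ.image (partialSum J) := by
        rw [Finset.mem_image]
        rintro ⟨t, -, ht⟩
        have h1 := (hiff t).1 ht.ge
        have := (partialSum_strictMono J).monotone h1
        omega
      rw [if_neg hne, Finset.filter_image, Finset.sum_image
        ((partialSum_strictMono J).injective.injOn)]
      refine Finset.sum_congr ?_ fun _ _ => rfl
      ext t
      simp [hiff]

theorem setPartCoeff_eq_card {N : ℕ} {I : Fin n → ℕ+} (J : Fin n → ℕ+) (hI : compWeight I = N) :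
    setPartCoeff I J = (Finset.univ.filter fun P : Finpartition (Finset.Icc 1 N) =>
      blockSizes P = List.ofFn (fun s => (I s : ℕ)) ∧
      maxSet P = Finset.univ.image (partialSum J)).card := by
  subst hI
  simp only [setPartCoeff, maximaSteps_eq_iff]

/-- The generating function of the numbers `c_{IJ}`, for fixed `J`. -/
theorem sum_setPartCoeff (J : Fin n → ℕ+) :
    ∑ I ∈ compsOf n (compWeight J), (setPartCoeff I J : MvPolynomial (Fin n) ℤ) *
        ∏ s, MvPolynomial.X s ^ ((I s : ℕ) - 1) =
      ∏ s, (∑ t ∈ Finset.Ici s, MvPolynomial.X t) ^ ((J s : ℕ) - 1) := by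
  classical
  set N := compWeight J with hN
  set D := Finset.univ.image (partialSum J) with hD
  have hDN : D ⊆ Finset.Icc 1 N := by
    intro d hd
    obtain ⟨s, -, rfl⟩ := Finset.mem_image.1 hd
    exact partialSum_mem J s
  let y : ℕ → MvPolynomial (Fin n) ℤ := Function.extend (partialSum J) MvPolynomial.X 0
  have hy : ∀ s, y (partialSum J s) = MvPolynomial.X s :=
    fun s => (partialSum_strictMono J).injective.extend_apply _ _ s
  have hX : (∏ s, MvPolynomial.X s : MvPolynomial (Fin n) ℤ) ≠ 0 :=
    Finset.prod_ne_zero_iff.2 fun s _ => MvPolynomial.X_ne_zero s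
  refine mul_left_cancel₀ hX ?_
  have hR := prod_sum_allowed J y
  rw [← sum_prod_blockMax hDN y, Finset.prod_mul_distrib] at hR
  simp only [hy] at hR
  rw [← hR, Finset.mul_sum]
  have h1 : ∀ I ∈ compsOf n N, (∏ s, MvPolynomial.X s) *
      ((setPartCoeff I J : MvPolynomial (Fin n) ℤ) * ∏ s, MvPolynomial.X s ^ ((I s : ℕ) - 1)) =
      ∑ P : Finpartition (Finset.Icc 1 N) with
        blockSizes P = List.ofFn (fun s => (I s : ℕ)) ∧ maxSet P = D,
        ∏ s, MvPolynomial.X s ^ (I s : ℕ) := by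
    intro I hI
    rw [setPartCoeff_eq_card J (mem_compsOf.1 hI), Finset.sum_const, nsmul_eq_mul, mul_left_comm,
      ← Finset.prod_mul_distrib]
    congr 1
    refine Finset.prod_congr rfl fun s _ => ?_
    rw [← pow_succ', Nat.sub_add_cancel (I s).pos]
  rw [Finset.sum_congr rfl h1]
  simp only [Finset.sum_filter]
  rw [Finset.sum_comm]
  refine Finset.sum_congr rfl fun P _ => ?_
  by_cases hP : maxSet P = D
  · have hpos : ∀ s, 0 < (P.part (partialSum J s)).card := fun s =>
      Finset.card_pos.2 (P.part_nonempty.2 (partialSum_mem J s))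
    let I : Fin n → ℕ+ := fun s => ⟨_, hpos s⟩
    have hI : I ∈ compsOf n N := mem_compsOf.2 (sum_card_part hP)
    rw [Finset.sum_eq_single_of_mem I hI, if_pos hP, if_pos ⟨blockSizes_eq hP, hP⟩,
      prod_blockMax hP]
    · simp only [hy]
      rfl
    · intro I' _ hne
      refine if_neg fun h => hne ?_
      have h2 := h.1
      rw [blockSizes_eq hP] at h2
      have h3 := List.ofFn_injective h2
      funext s
      exact PNat.coe_injective (congrFun h3 s).symm
  · rw [if_neg hP]
    exact Finset.sum_eq_zero fun I _ => if_neg fun h => hP h.2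

end GeneratingFunction

/-! ### Recurrences for the set-partition coefficients -/

section LinFormCoeff

variable {n : ℕ}

/-- The product `∏ₛ (x_s + ⋯ + x_n)^{f_s}`. -/
noncomputable def linFormProd (f : Fin n → ℕ) : MvPolynomial (Fin n) ℤ :=
  ∏ s, (∑ t ∈ Finset.Ici s, MvPolynomial.X t) ^ f s

/-- The coefficient of `x^e` in `∏ₛ (x_s + ⋯ + x_n)^{f_s}`. -/
noncomputable def linFormCoeff (e f : Fin n → ℕ) : ℤ :=
  MvPolynomial.coeff (Finsupp.equivFunOnFinite.symm e) (linFormProd f)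

/-- The tuple `e` with its entry at `t` decreased by one. -/
def decAt (e : Fin n → ℕ) (t : Fin n) : Fin n → ℕ := Function.update e t (e t - 1)

theorem monomial_eq_prod_fin (e : Fin n → ℕ) :
    (∏ s, MvPolynomial.X s ^ e s : MvPolynomial (Fin n) ℤ) =
      MvPolynomial.monomial (Finsupp.equivFunOnFinite.symm e) 1 := by
  rw [MvPolynomial.monomial_eq, map_one, one_mul, Finsupp.prod_fintype _ _ (by simp)]
  rfl

theorem setPartCoeff_eq_linFormCoeff {I J : Fin n → ℕ+} (h : compWeight I = compWeight J) :
    (setPartCoeff I J : ℤ) =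
      linFormCoeff (fun s => (I s : ℕ) - 1) (fun s => (J s : ℕ) - 1) := by
  have hI : I ∈ compsOf n (compWeight J) := mem_compsOf.2 h
  rw [linFormCoeff, linFormProd, ← sum_setPartCoeff, MvPolynomial.coeff_sum,
    Finset.sum_eq_single_of_mem I hI]
  · rw [monomial_eq_prod_fin fun s => (I s : ℕ) - 1,
      ← map_natCast (MvPolynomial.C (σ := Fin n) (R := ℤ)), MvPolynomial.coeff_C_mul,
      MvPolynomial.coeff_monomial, if_pos rfl, mul_one]
  · intro I' _ hne
    rw [monomial_eq_prod_fin fun s => (I' s : ℕ) - 1,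
      ← map_natCast (MvPolynomial.C (σ := Fin n) (R := ℤ)), MvPolynomial.coeff_C_mul,
      MvPolynomial.coeff_monomial, if_neg, mul_zero]
    intro heq
    refine hne (funext fun s => PNat.coe_injective ?_)
    have := congrFun (Finsupp.equivFunOnFinite.symm.injective heq) s
    have h1 := (I' s).pos
    have h2 := (I s).pos
    omega

theorem linFormProd_cons_zero (f : Fin n → ℕ) :
    linFormProd (Fin.cons 0 f : Fin (n + 1) → ℕ) =
      MvPolynomial.rename Fin.succ (linFormProd f) := by
  simp only [linFormProd, Fin.prod_univ_succ, Fin.cons_zero, pow_zero, one_mul, Fin.cons_succ,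
    sum_Ici_succ_fin, map_prod, map_pow, map_sum, MvPolynomial.rename_X]

theorem linFormCoeff_cons_zero (e : Fin (n + 1) → ℕ) (f : Fin n → ℕ) :
    linFormCoeff e (Fin.cons 0 f) = if e 0 = 0 then linFormCoeff (Fin.tail e) f else 0 := by
  rw [linFormCoeff, linFormProd_cons_zero]
  split_ifs with h
  · have : Finsupp.equivFunOnFinite.symm e =
        (Finsupp.equivFunOnFinite.symm (Fin.tail e)).mapDomain Fin.succ := by
      ext i
      refine Fin.cases ?_ (fun j => ?_) i
      · rw [Finsupp.mapDomain_of_notMem_range _ _ (by simp)]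
        exact h
      · rw [Finsupp.mapDomain_apply (Fin.succ_injective n)]
        rfl
    rw [this, MvPolynomial.coeff_rename_mapDomain _ (Fin.succ_injective n), linFormCoeff]
  · refine MvPolynomial.coeff_rename_eq_zero _ _ _ fun u hu => absurd ?_ h
    have := DFunLike.congr_fun hu 0
    rw [Finsupp.mapDomain_of_notMem_range _ _ (by simp)] at this
    exact this.symm

theorem linFormProd_cons_succ (k : ℕ) (f : Fin n → ℕ) :
    linFormProd (Fin.cons (k + 1) f : Fin (n + 1) → ℕ) =
      ∑ t, MvPolynomial.X t * linFormProd (Fin.cons k f : Fin (n + 1) → ℕ) := by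
  rw [← Finset.sum_mul]
  simp only [linFormProd, Fin.prod_univ_succ (n := n), Fin.cons_zero, Fin.cons_succ,
    sum_Ici_zero_fin, pow_succ' _ k, mul_assoc]

theorem linFormCoeff_cons_succ (e : Fin (n + 1) → ℕ) (k : ℕ) (f : Fin n → ℕ) :
    linFormCoeff e (Fin.cons (k + 1) f) =
      ∑ t, if e t = 0 then 0 else linFormCoeff (decAt e t) (Fin.cons k f) := by
  classical
  rw [linFormCoeff, linFormProd_cons_succ, MvPolynomial.coeff_sum]
  refine Finset.sum_congr rfl fun t _ => ?_
  rw [MvPolynomial.coeff_X_mul']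
  by_cases h : e t = 0
  · rw [if_pos h, if_neg]
    simpa using h
  · rw [if_neg h, if_pos (by simpa using h), linFormCoeff]
    congr 1
    ext i
    rw [Finsupp.tsub_apply, Finsupp.single_apply]
    simp only [Finsupp.equivFunOnFinite_symm_apply_apply, decAt, Function.update_apply]
    by_cases hi : i = t
    · subst hi; simp
    · simp [hi, Ne.symm hi]

theorem linFormCoeff_ne_zero {e f : Fin n → ℕ} (h : linFormCoeff e f ≠ 0) :
    e = f ∨ ∃ i, (∀ j < i, e j = f j) ∧ e i < f i := by
  induction n with
  | zero => exact Or.inl (Subsingleton.elim _ _)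
  | succ n ih =>
    obtain ⟨k, f, rfl⟩ : ∃ k f', f = Fin.cons k f' := ⟨f 0, Fin.tail f, (Fin.cons_self_tail f).symm⟩
    induction k generalizing e with
    | zero =>
      rw [linFormCoeff_cons_zero] at h
      obtain ⟨h0, h1⟩ := ite_ne_right_iff.1 h
      rcases ih h1 with h2 | ⟨i, h2, h3⟩
      · left
        rw [← Fin.cons_self_tail e, h2, h0]
      · refine Or.inr ⟨i.succ, fun j hj => ?_, h3⟩
        refine Fin.cases (fun _ => h0) (fun j hj => h2 j (Fin.succ_lt_succ_iff.1 hj)) j hj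
    | succ k ihk =>
      rw [linFormCoeff_cons_succ] at h
      obtain ⟨t, -, ht⟩ := Finset.exists_ne_zero_of_sum_ne_zero h
      obtain ⟨ht0, ht⟩ := ite_ne_left_iff.1 ht
      have hk := ihk ht.symm
      by_cases htz : t = 0
      · subst htz
        have htail : ∀ j : Fin n, decAt e 0 j.succ = e j.succ := fun j => by simp [decAt]
        have hzero : decAt e 0 0 = e 0 - 1 := by simp [decAt]
        rcases hk with hk | ⟨i, h2, h3⟩
        · left
          funext j
          refine Fin.cases ?_ (fun j => ?_) j
          · have := congrFun hk 0
            rw [hzero] at this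
            simp only [Fin.cons_zero] at this ⊢
            omega
          · rw [← htail, hk, Fin.cons_succ, Fin.cons_succ]
        · right
          refine ⟨i, fun j hj => ?_, ?_⟩
          · have := h2 j hj
            revert this
            refine Fin.cases ?_ (fun j => ?_) j
            · rw [hzero, Fin.cons_zero, Fin.cons_zero]; omega
            · rw [htail, Fin.cons_succ, Fin.cons_succ]; exact id
          · revert h3
            refine Fin.cases ?_ (fun j => ?_) i
            · rw [hzero, Fin.cons_zero, Fin.cons_zero]; omega
            · rw [htail, Fin.cons_succ, Fin.cons_succ]; exact id
      · have hzero : decAt e t 0 = e 0 := by simp [decAt, Ne.symm htz]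
        refine Or.inr ⟨0, fun j hj => absurd hj (Fin.not_lt_zero j), ?_⟩
        rw [Fin.cons_zero, ← hzero, Nat.lt_succ_iff]
        rcases hk with hk | ⟨i, h2, h3⟩
        · exact (congrFun hk 0).le
        · by_cases hi : i = 0
          · subst hi; exact h3.le
          · exact (h2 0 (Fin.pos_of_ne_zero hi)).le

theorem linFormCoeff_self (e : Fin n → ℕ) : linFormCoeff e e = 1 := by
  induction n with
  | zero =>
    rw [linFormCoeff, linFormProd, Finset.univ_eq_empty, Finset.prod_empty,
      show Finsupp.equivFunOnFinite.symm e = 0 from Subsingleton.elim _ _,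
      MvPolynomial.coeff_zero_one]
  | succ n ih =>
    obtain ⟨k, e, rfl⟩ : ∃ k e', e = Fin.cons k e' := ⟨e 0, Fin.tail e, (Fin.cons_self_tail e).symm⟩
    induction k with
    | zero => rw [linFormCoeff_cons_zero, Fin.cons_zero, if_pos rfl, Fin.tail_cons, ih]
    | succ k ihk =>
      rw [linFormCoeff_cons_succ, Finset.sum_eq_single_of_mem 0 (Finset.mem_univ _)]
      · simpa [decAt] using ihk
      · intro t _ ht
        by_contra hne
        rcases linFormCoeff_ne_zero (ite_ne_left_iff.1 hne).2.symm with h | ⟨i, h2, h3⟩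
        · have := congrFun h 0
          simp [decAt, Ne.symm ht] at this
        · by_cases hi : i = 0
          · subst hi
            simp [decAt, Ne.symm ht] at h3
          · have := h2 0 (Fin.pos_of_ne_zero hi)
            simp [decAt, Ne.symm ht] at this

theorem setPartCoeff_self (I : Fin n → ℕ+) : setPartCoeff I I = 1 := by
  have := setPartCoeff_eq_linFormCoeff (rfl : compWeight I = compWeight I)
  rw [linFormCoeff_self] at this
  exact_mod_cast this

theorem toLex_le_of_setPartCoeff_ne_zero {I J : Fin n → ℕ+} (hw : compWeight I = compWeight J)
    (h : setPartCoeff I J ≠ 0) : toLex I ≤ toLex J := by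
  have h1 : linFormCoeff (fun s => (I s : ℕ) - 1) (fun s => (J s : ℕ) - 1) ≠ 0 := by
    rw [← setPartCoeff_eq_linFormCoeff hw]
    exact_mod_cast h
  rcases linFormCoeff_ne_zero h1 with h2 | ⟨i, h2, h3⟩
  · refine le_of_eq (congrArg toLex (funext fun s => PNat.coe_injective ?_))
    have := congrFun h2 s
    have h3 := (I s).pos
    have h4 := (J s).pos
    omega
  · refine le_of_lt ⟨i, fun j hj => PNat.coe_injective ?_, ?_⟩
    · have := h2 j hj
      have h3 := (I j).pos
      have h4 := (J j).pos
      change (I j : ℕ) = J j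
      omega
    · change (I i : ℕ) < J i
      omega

end LinFormCoeff

section Antidiagonal

theorem sum_antidiagonalTuple_succ_zero {M : Type*} [AddCommMonoid M] {n : ℕ}
    (F : (Fin (n + 1) → ℕ) → M) :
    ∑ f ∈ Finset.Nat.antidiagonalTuple (n + 1) 0, F f =
      ∑ f ∈ Finset.Nat.antidiagonalTuple n 0, F (Fin.cons 0 f) := by
  rw [Finset.Nat.antidiagonalTuple_zero_right, Finset.Nat.antidiagonalTuple_zero_right,
    Finset.sum_singleton, Finset.sum_singleton]
  congr 1
  funext i
  refine Fin.cases rfl (fun j => rfl) i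

theorem sum_antidiagonalTuple_succ_succ {M : Type*} [AddCommMonoid M] {n N : ℕ}
    (F : (Fin (n + 1) → ℕ) → M) :
    ∑ f ∈ Finset.Nat.antidiagonalTuple (n + 1) (N + 1), F f =
      ∑ f ∈ Finset.Nat.antidiagonalTuple n (N + 1), F (Fin.cons 0 f) +
      ∑ f ∈ Finset.Nat.antidiagonalTuple (n + 1) N, F (Fin.cons (f 0 + 1) (Fin.tail f)) := by
  classical
  rw [← Finset.sum_filter_add_sum_filter_not _ (fun f => f 0 = 0)]
  congr 1
  · refine Finset.sum_nbij' Fin.tail (fun f => Fin.cons 0 f) ?_ ?_ ?_ ?_ ?_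
    · intro f hf
      rw [Finset.mem_filter, Finset.Nat.mem_antidiagonalTuple, Fin.sum_univ_succ] at hf
      rw [Finset.Nat.mem_antidiagonalTuple, ← hf.1, hf.2, zero_add]
      rfl
    · intro f hf
      rw [Finset.Nat.mem_antidiagonalTuple] at hf
      rw [Finset.mem_filter, Finset.Nat.mem_antidiagonalTuple, Fin.sum_univ_succ]
      simp [hf]
    · intro f hf
      rw [← (Finset.mem_filter.1 hf).2, Fin.cons_self_tail]
    · intro f _
      rw [Fin.tail_cons]
    · intro f hf
      rw [← (Finset.mem_filter.1 hf).2, Fin.cons_self_tail]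
  · refine Finset.sum_nbij' (fun f => Fin.cons (f 0 - 1) (Fin.tail f))
      (fun f => Fin.cons (f 0 + 1) (Fin.tail f)) ?_ ?_ ?_ ?_ ?_
    · intro f hf
      rw [Finset.mem_filter, Finset.Nat.mem_antidiagonalTuple, Fin.sum_univ_succ] at hf
      rw [Finset.Nat.mem_antidiagonalTuple, Fin.sum_univ_succ]
      simp only [Fin.cons_zero, Fin.cons_succ, Fin.tail]
      omega
    · intro f hf
      rw [Finset.Nat.mem_antidiagonalTuple, Fin.sum_univ_succ] at hf
      rw [Finset.mem_filter, Finset.Nat.mem_antidiagonalTuple, Fin.sum_univ_succ]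
      simp only [Fin.cons_zero, Fin.cons_succ, Fin.tail]
      omega
    · intro f hf
      have := (Finset.mem_filter.1 hf).2
      simp only [Fin.cons_zero, Fin.tail_cons]
      rw [Nat.sub_add_cancel (by omega), Fin.cons_self_tail]
    · intro f _
      simp only [Fin.cons_zero, Fin.tail_cons, Nat.add_sub_cancel, Fin.cons_self_tail]
    · intro f hf
      have := (Finset.mem_filter.1 hf).2
      simp only [Fin.cons_zero, Fin.tail_cons]
      rw [Nat.sub_add_cancel (by omega), Fin.cons_self_tail]

end Antidiagonal

section LinFormSeries

variable {L : Type*} [Field L] {n : ℕ}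

/-- The product of the inverse powers `(w_i + ⋯ + w_n)^{-(f_i+1)}`. -/
def suffixInvProd (w : Fin n → L) (f : Fin n → ℕ) : L :=
  ∏ i, ((∑ k ∈ Finset.Ici i, w k) ^ (f i + 1))⁻¹

/-- The coefficient of `x^e` in the series `∏ᵢ ((w_i - x_i) + ⋯ + (w_n - x_n))⁻¹`. -/
noncomputable def linFormSeries (w : Fin n → L) (e : Fin n → ℕ) : L :=
  ∑ f ∈ Finset.Nat.antidiagonalTuple n (∑ i, e i), (linFormCoeff e f : L) * suffixInvProd w f

theorem suffixInvProd_cons (w : Fin (n + 1) → L) (k : ℕ) (f : Fin n → ℕ) :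
    suffixInvProd w (Fin.cons k f) =
      ((∑ i, w i) ^ (k + 1))⁻¹ * suffixInvProd (Fin.tail w) f := by
  simp only [suffixInvProd, Fin.prod_univ_succ, Fin.cons_zero, Fin.cons_succ, sum_Ici_zero_fin,
    sum_Ici_succ_fin]
  rfl

theorem sum_decAt {e : Fin n → ℕ} {t : Fin n} (ht : e t ≠ 0) :
    ∑ i, decAt e t i + 1 = ∑ i, e i := by
  rw [← Finset.add_sum_erase _ _ (Finset.mem_univ t),
    ← Finset.add_sum_erase _ _ (Finset.mem_univ t)]
  have : ∑ i ∈ Finset.univ.erase t, decAt e t i = ∑ i ∈ Finset.univ.erase t, e i :=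
    Finset.sum_congr rfl fun i hi => by simp [decAt, (Finset.mem_erase.1 hi).1]
  rw [this]
  simp only [decAt, Function.update_self]
  omega

theorem linFormSeries_zero (w : Fin 0 → L) (e : Fin 0 → ℕ) : linFormSeries w e = 1 := by
  have h : ∀ f : Fin 0 → ℕ, linFormCoeff e f = 1 := fun f => by
    rw [Subsingleton.elim f e, linFormCoeff_self]
  simp [linFormSeries, h, suffixInvProd]

theorem mul_linFormSeries (w : Fin (n + 1) → L) (hw : ∑ i, w i ≠ 0) (e : Fin (n + 1) → ℕ) :
    (∑ i, w i) * linFormSeries w e =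
      (∑ t, if e t = 0 then 0 else linFormSeries w (decAt e t)) +
        if e 0 = 0 then linFormSeries (Fin.tail w) (Fin.tail e) else 0 := by
  set U := ∑ i, w i with hU
  have hzero : ∑ f ∈ Finset.Nat.antidiagonalTuple n (∑ i, e i),
      U * ((linFormCoeff e (Fin.cons 0 f) : L) * suffixInvProd w (Fin.cons 0 f)) =
      if e 0 = 0 then linFormSeries (Fin.tail w) (Fin.tail e) else 0 := by
    split_ifs with h
    · have hs : ∑ i, e i = ∑ i, Fin.tail e i := by
        rw [Fin.sum_univ_succ, h, zero_add]; rfl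
      rw [hs, linFormSeries]
      refine Finset.sum_congr rfl fun f _ => ?_
      rw [linFormCoeff_cons_zero, if_pos h, suffixInvProd_cons, ← hU, zero_add, pow_one,
        mul_left_comm, mul_inv_cancel_left₀ hw]
    · refine Finset.sum_eq_zero fun f _ => ?_
      rw [linFormCoeff_cons_zero, if_neg h]
      simp
  have hterm : ∀ f : Fin (n + 1) → ℕ,
      U * ((linFormCoeff e (Fin.cons (f 0 + 1) (Fin.tail f)) : L) *
        suffixInvProd w (Fin.cons (f 0 + 1) (Fin.tail f))) =
      ∑ t, if e t = 0 then 0 else (linFormCoeff (decAt e t) f : L) * suffixInvProd w f := by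
    intro f
    have h1 : U * suffixInvProd w (Fin.cons (f 0 + 1) (Fin.tail f)) = suffixInvProd w f := by
      conv_rhs => rw [← Fin.cons_self_tail f]
      rw [suffixInvProd_cons, suffixInvProd_cons, ← hU, ← mul_assoc]
      congr 1
      rw [pow_succ' U (f 0 + 1), mul_inv, mul_inv_cancel_left₀ hw]
    rw [mul_left_comm, h1, linFormCoeff_cons_succ, Fin.cons_self_tail, Int.cast_sum,
      Finset.sum_mul]
    refine Finset.sum_congr rfl fun t _ => ?_
    split_ifs <;> simp
  rw [← hzero]
  conv_lhs => rw [linFormSeries, Finset.mul_sum]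
  rcases hN : ∑ i, e i with _ | N
  · rw [sum_antidiagonalTuple_succ_zero]
    have : ∀ t, e t = 0 := fun t =>
      (Finset.sum_eq_zero_iff.1 hN) t (Finset.mem_univ t)
    simp [this]
  · rw [sum_antidiagonalTuple_succ_succ, add_comm]
    congr 1
    rw [Finset.sum_congr rfl fun f _ => hterm f, Finset.sum_comm]
    refine Finset.sum_congr rfl fun t _ => ?_
    split_ifs with h
    · simp
    · have : ∑ i, decAt e t i = N := by
        have := sum_decAt h
        omega
      rw [linFormSeries, this]

end LinFormSeries

/-! ### Functions on words that are multiplicative for the shuffle -/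

section DecWords

variable {α : Type*}

/-- The words obtained from a word with letters in `α × ℕ` by decreasing one of the exponents
by one. -/
def decWords : List (α × ℕ) → Multiset (List (α × ℕ))
  | [] => 0
  | p :: x => (if p.2 = 0 then 0 else {(p.1, p.2 - 1) :: x}) + (decWords x).map (List.cons p)

theorem mem_decWords {x y : List (α × ℕ)} (h : y ∈ decWords x) :
    y.map Prod.fst = x.map Prod.fst ∧ (y.map Prod.snd).sum + 1 = (x.map Prod.snd).sum := by
  induction x generalizing y with
  | nil => simp [decWords] at h
  | cons p x ih =>
    rw [decWords, Multiset.mem_add, Multiset.mem_map] at h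
    rcases h with h | ⟨z, hz, rfl⟩
    · split_ifs at h with h0
      · simp at h
      · rw [Multiset.mem_singleton] at h
        subst h
        simp only [List.map_cons, List.sum_cons, true_and]
        omega
    · obtain ⟨h1, h2⟩ := ih hz
      simp only [List.map_cons, List.sum_cons, h1, ← h2, true_and]
      omega

/-- Decreasing an exponent is a derivation of the shuffle product. -/
theorem shuffle_bind_decWords : ∀ u v : List (α × ℕ),
    (shuffle u v).bind decWords =
      (decWords u).bind (fun x => shuffle x v) + (decWords v).bind (fun y => shuffle u y)
  | [], v => by
    simp only [shuffle_nil_left, Multiset.singleton_bind, decWords, Multiset.zero_bind, zero_add]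
    exact ((Multiset.bind_singleton _ id).trans (Multiset.map_id _)).symm
  | a :: u, [] => by
    simp only [shuffle_nil_right, Multiset.singleton_bind, decWords, Multiset.zero_bind, add_zero]
    exact ((Multiset.bind_singleton _ id).trans (Multiset.map_id _)).symm
  | a :: u, b :: v => by
    have h1 := shuffle_bind_decWords u (b :: v)
    have h2 := shuffle_bind_decWords (a :: u) v
    have hb : ∀ (p : α × ℕ) (s : Multiset (List (α × ℕ))), (s.map (List.cons p)).bind decWords =
        (if p.2 = 0 then 0 else s.map (List.cons (p.1, p.2 - 1))) +
          (s.bind decWords).map (List.cons p) := by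
      intro p s
      rw [Multiset.bind_map]
      simp only [decWords, Multiset.bind_add, Multiset.map_bind]
      congr 1
      split_ifs
      · exact Multiset.bind_zero _
      · exact Multiset.bind_singleton _ _
    rw [shuffle_cons_cons, Multiset.add_bind, hb, hb, h1, h2]
    simp only [decWords, Multiset.add_bind, Multiset.bind_map, shuffle_cons_cons,
      Multiset.bind_add, Multiset.map_bind, Multiset.map_add]
    by_cases ha : a.2 = 0 <;> by_cases hb : b.2 = 0 <;>
      simp only [ha, hb, if_true, if_false, Multiset.zero_bind, Multiset.singleton_bind,
        shuffle_cons_cons] <;> abel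
termination_by u v => u.length + v.length

theorem decWords_ofFn {n : ℕ} (w : Fin n → α) (e : Fin n → ℕ) :
    decWords (List.ofFn fun i => (w i, e i)) =
      ∑ t, if e t = 0 then 0 else {List.ofFn fun i => (w i, decAt e t i)} := by
  induction n with
  | zero => simp [decWords]
  | succ n ih =>
    rw [List.ofFn_succ, decWords, ih, Fin.sum_univ_succ]
    congr 1
    · split_ifs
      · rfl
      · simp [List.ofFn_succ, decAt]
    · rw [← Multiset.coe_mapAddMonoidHom, map_sum]
      refine Finset.sum_congr rfl fun t _ => ?_
      split_ifs
      · simp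
      · rw [Multiset.coe_mapAddMonoidHom, Multiset.map_singleton, List.ofFn_succ]
        have h0 : decAt e t.succ 0 = e 0 := Function.update_of_ne (Fin.succ_ne_zero t).symm _ _
        have hs : ∀ i : Fin n, decAt e t.succ i.succ = decAt (fun i => e i.succ) t i := by
          intro i
          simp [decAt, Function.update_apply]
        simp only [h0, hs]

end DecWords

section ShuffleMultiplicative

variable {L : Type*} [Field L] {P : AddSubsemigroup L}

/-- The contribution of the tail of a word whose first letter has exponent zero. -/
def tailTerm (ψ : List (L × ℕ) → L) : List (L × ℕ) → L
  | [] => 0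
  | p :: x => if p.2 = 0 then ψ x else 0

theorem list_sum_mem_of_ne_nil {l : List L} (hl : ∀ a ∈ l, a ∈ P) (h : l ≠ []) : l.sum ∈ P := by
  induction l with
  | nil => exact absurd rfl h
  | cons a l ih =>
    rw [List.sum_cons]
    by_cases hl' : l = []
    · subst hl'
      simpa using hl a (by simp)
    · exact P.add_mem (hl a (by simp)) (ih (fun b hb => hl b (by simp [hb])) hl')

theorem sum_map_shuffle_tailTerm (ψ : List (L × ℕ) → L) (a b : L × ℕ) (u v : List (L × ℕ)) :
    ((shuffle (a :: u) (b :: v)).map (tailTerm ψ)).sum =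
      (if a.2 = 0 then ((shuffle u (b :: v)).map ψ).sum else 0) +
        if b.2 = 0 then ((shuffle (a :: u) v).map ψ).sum else 0 := by
  rw [shuffle_cons_cons, Multiset.map_add, Multiset.sum_add, Multiset.map_map, Multiset.map_map]
  simp only [Function.comp_def, tailTerm]
  congr 1 <;> split_ifs <;> simp

/-- A function on words which satisfies the recurrence of the coefficients of
`∏ᵢ ((w_i - x_i) + ⋯ + (w_n - x_n))⁻¹` is multiplicative for the shuffle. -/
theorem mul_eq_sum_shuffle_of_recurrence (hP : (0 : L) ∉ P) {ψ : List (L × ℕ) → L}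
    (hnil : ψ [] = 1)
    (hrec : ∀ x, x ≠ [] → (∀ p ∈ x, p.1 ∈ P) →
      (x.map Prod.fst).sum * ψ x = ((decWords x).map ψ).sum + tailTerm ψ x)
    (u v : List (L × ℕ)) (hu : ∀ p ∈ u, p.1 ∈ P) (hv : ∀ p ∈ v, p.1 ∈ P) :
    ψ u * ψ v = ((shuffle u v).map ψ).sum := by
  obtain ⟨N, hN⟩ : ∃ N, N = u.length + v.length + (u.map Prod.snd).sum + (v.map Prod.snd).sum :=
    ⟨_, rfl⟩
  induction N using Nat.strong_induction_on generalizing u v with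
  | _ N ih =>
  rcases u with _ | ⟨a, u⟩
  · simp [shuffle_nil_left, hnil]
  rcases v with _ | ⟨b, v⟩
  · simp [shuffle_nil_right, hnil]
  have hletters : ∀ {x y : List (L × ℕ)}, y.map Prod.fst = x.map Prod.fst →
      (∀ p ∈ x, p.1 ∈ P) → ∀ p ∈ y, p.1 ∈ P := by
    intro x y hxy hx p hp
    have : p.1 ∈ x.map Prod.fst := hxy ▸ List.mem_map_of_mem hp
    obtain ⟨q, hq, hqp⟩ := List.mem_map.1 this
    exact hqp ▸ hx q hq
  have hlen : ∀ {x y : List (L × ℕ)}, y.map Prod.fst = x.map Prod.fst → y.length = x.length := by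
    intro x y hxy
    simpa using congrArg List.length hxy
  have hsum : ∀ {x : List (L × ℕ)}, x ≠ [] → (∀ p ∈ x, p.1 ∈ P) → (x.map Prod.fst).sum ∈ P := by
    intro x hx hxP
    refine list_sum_mem_of_ne_nil (fun c hc => ?_) (by simpa using hx)
    obtain ⟨p, hp, rfl⟩ := List.mem_map.1 hc
    exact hxP p hp
  set U := a :: u with hU
  set V := b :: v with hV
  set A := (U.map Prod.fst).sum with hA
  set B := (V.map Prod.fst).sum with hB
  have hAB : A + B ≠ 0 := fun h =>
    hP (h ▸ P.add_mem (hsum (by simp [hU]) hu) (hsum (by simp [hV]) hv))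
  refine mul_left_cancel₀ hAB ?_
  have hleft : (A + B) * (ψ U * ψ V) = (A * ψ U) * ψ V + ψ U * (B * ψ V) := by ring
  rw [hleft, hrec U (by simp [hU]) hu, hrec V (by simp [hV]) hv]
  have hright : (A + B) * ((shuffle U V).map ψ).sum =
      (((shuffle U V).bind decWords).map ψ).sum + ((shuffle U V).map (tailTerm ψ)).sum := by
    rw [← Multiset.sum_map_mul_left, Multiset.map_bind, Multiset.sum_bind, ← Multiset.sum_map_add]
    refine congrArg _ (Multiset.map_congr rfl fun x hx => ?_)
    have hp := perm_of_mem_shuffle _ _ _ hx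
    have hx0 : x ≠ [] := by
      rintro rfl
      simpa [hU] using hp.length_eq
    have hxP : ∀ p ∈ x, p.1 ∈ P := fun p hp' => by
      rcases List.mem_append.1 (hp.mem_iff.1 hp') with h | h
      · exact hu p h
      · exact hv p h
    have hxs : (x.map Prod.fst).sum = A + B := by
      rw [(hp.map Prod.fst).sum_eq, List.map_append, List.sum_append]
    rw [← hxs, hrec x hx0 hxP]
  rw [hright, shuffle_bind_decWords, hU, hV, sum_map_shuffle_tailTerm, ← hU, ← hV,
    Multiset.map_add, Multiset.sum_add, Multiset.map_bind, Multiset.map_bind, Multiset.sum_bind,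
    Multiset.sum_bind]
  have hdu : ((decWords U).map ψ).sum * ψ V =
      ((decWords U).map fun x => ((shuffle x V).map ψ).sum).sum := by
    rw [← Multiset.sum_map_mul_right]
    refine congrArg _ (Multiset.map_congr rfl fun x hx => ?_)
    obtain ⟨h1, h2⟩ := mem_decWords hx
    refine ih _ ?_ x V (hletters h1 hu) hv rfl
    have := hlen h1
    omega
  have hdv : ψ U * ((decWords V).map ψ).sum =
      ((decWords V).map fun y => ((shuffle U y).map ψ).sum).sum := by
    rw [← Multiset.sum_map_mul_left]
    refine congrArg _ (Multiset.map_congr rfl fun x hx => ?_)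
    obtain ⟨h1, h2⟩ := mem_decWords hx
    refine ih _ ?_ U x hu (hletters h1 hv) rfl
    have := hlen h1
    omega
  have htu : tailTerm ψ U * ψ V = if a.2 = 0 then ((shuffle u V).map ψ).sum else 0 := by
    rw [hU, tailTerm]
    split_ifs
    · refine ih _ ?_ u V (fun p hp => hu p (by simp [hU, hp])) hv rfl
      simp only [hN, hU, List.length_cons, List.map_cons, List.sum_cons]
      omega
    · exact zero_mul _
  have htv : ψ U * tailTerm ψ V = if b.2 = 0 then ((shuffle U v).map ψ).sum else 0 := by
    rw [hV, tailTerm]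
    split_ifs
    · refine ih _ ?_ U v hu (fun p hp => hv p (by simp [hV, hp])) rfl
      simp only [hN, hV, List.length_cons, List.map_cons, List.sum_cons]
      omega
    · exact mul_zero _
  rw [← hdu, ← hdv, ← htu, ← htv]
  ring

/-- The product of the inverses of the sums of the nonempty suffixes of a word. -/
def invSuffixSums : List L → L
  | [] => 1
  | a :: x => (a + x.sum)⁻¹ * invSuffixSums x

theorem invSuffixSums_mul (hP : (0 : L) ∉ P) : ∀ u v : List L,
    (∀ s, s <:+ u → s ≠ [] → s.sum ∈ P) → (∀ s, s <:+ v → s ≠ [] → s.sum ∈ P) →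
    invSuffixSums u * invSuffixSums v = ((shuffle u v).map invSuffixSums).sum
  | [], v, _, _ => by simp [shuffle_nil_left, invSuffixSums]
  | a :: u, [], _, _ => by simp [shuffle_nil_right, invSuffixSums]
  | a :: u, b :: v, hu, hv => by
    have h1 := invSuffixSums_mul hP u (b :: v)
      (fun s hs => hu s (hs.trans (List.suffix_cons a u))) hv
    have h2 := invSuffixSums_mul hP (a :: u) v hu
      (fun s hs => hv s (hs.trans (List.suffix_cons b v)))
    have hA := hu (a :: u) List.suffix_rfl (by simp)
    have hB := hv (b :: v) List.suffix_rfl (by simp)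
    rw [List.sum_cons] at hA hB
    have hA0 : a + u.sum ≠ 0 := fun h => hP (h ▸ hA)
    have hB0 : b + v.sum ≠ 0 := fun h => hP (h ▸ hB)
    have hAB0 : (a + u.sum) + (b + v.sum) ≠ 0 := fun h => hP (h ▸ P.add_mem hA hB)
    have hl : ((shuffle u (b :: v)).map fun x => invSuffixSums (a :: x)).sum =
        ((a + u.sum) + (b + v.sum))⁻¹ * ((shuffle u (b :: v)).map invSuffixSums).sum := by
      rw [← Multiset.sum_map_mul_left]
      refine congrArg _ (Multiset.map_congr rfl fun x hx => ?_)
      rw [invSuffixSums, (perm_of_mem_shuffle _ _ _ hx).sum_eq, List.sum_append, List.sum_cons,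
        ← add_assoc]
    have hr : ((shuffle (a :: u) v).map fun x => invSuffixSums (b :: x)).sum =
        ((a + u.sum) + (b + v.sum))⁻¹ * ((shuffle (a :: u) v).map invSuffixSums).sum := by
      rw [← Multiset.sum_map_mul_left]
      refine congrArg _ (Multiset.map_congr rfl fun x hx => ?_)
      rw [invSuffixSums, (perm_of_mem_shuffle _ _ _ hx).sum_eq, List.sum_append, List.sum_cons,
        add_left_comm]
    rw [shuffle_cons_cons, Multiset.map_add, Multiset.sum_add, Multiset.map_map, Multiset.map_map]
    simp only [Function.comp_def]
    rw [hl, hr, ← h1, ← h2]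
    simp only [invSuffixSums]
    field_simp
termination_by u v => u.length + v.length

end ShuffleMultiplicative

section ExpandWord

/-- The word obtained by replacing each letter `(a, k)` by `k` zeros followed by `a`. -/
def expandWord {α : Type*} [Zero α] : List (α × ℕ) → List α
  | [] => []
  | p :: x => List.replicate p.2 0 ++ p.1 :: expandWord x

theorem map_expandWord {α β : Type*} [Zero α] [Zero β] (f : α → β) (hf : f 0 = 0)
    (x : List (α × ℕ)) :
    (expandWord x).map f = expandWord (x.map fun p => (f p.1, p.2)) := by
  induction x with
  | nil => rfl
  | cons p x ih => simp [expandWord, ih, hf]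

variable {L : Type*} [Field L] {P : AddSubsemigroup L}

theorem sum_expandWord (x : List (L × ℕ)) : (expandWord x).sum = (x.map Prod.fst).sum := by
  induction x with
  | nil => rfl
  | cons p x ih => simp [expandWord, ih]

theorem suffix_sum_expandWord_mem {x : List (L × ℕ)} (hx : ∀ p ∈ x, p.1 ∈ P) :
    ∀ s, s <:+ expandWord x → s ≠ [] → s.sum ∈ P := by
  induction x with
  | nil =>
    intro s hs h
    exact absurd (List.suffix_nil.1 hs) h
  | cons p x ih =>
    have hp : (p.1 :: expandWord x).sum ∈ P := by
      have : (p.1 :: expandWord x).sum = ((p :: x).map Prod.fst).sum := by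
        simp [sum_expandWord]
      rw [this]
      refine list_sum_mem_of_ne_nil (fun c hc => ?_) (by simp)
      obtain ⟨q, hq, rfl⟩ := List.mem_map.1 hc
      exact hx q hq
    rw [expandWord]
    induction p.2 with
    | zero =>
      intro s hs h
      rw [List.replicate_zero, List.nil_append, List.suffix_cons_iff] at hs
      rcases hs with rfl | hs
      · exact hp
      · exact ih (fun q hq => hx q (by simp [hq])) s hs h
    | succ k ihk =>
      intro s hs h
      rw [List.replicate_succ, List.cons_append, List.suffix_cons_iff] at hs
      rcases hs with rfl | hs
      · rw [List.sum_cons, zero_add]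
        exact ihk _ List.suffix_rfl (by simp)
      · exact ihk s hs h

theorem invSuffixSums_expandWord_cons (p : L × ℕ) (x : List (L × ℕ)) :
    invSuffixSums (expandWord (p :: x)) =
      ((p.1 + (x.map Prod.fst).sum) ^ (p.2 + 1))⁻¹ * invSuffixSums (expandWord x) := by
  rw [expandWord]
  induction p.2 with
  | zero => simp [invSuffixSums, sum_expandWord]
  | succ k ih =>
    rw [List.replicate_succ, List.cons_append, invSuffixSums, ih]
    simp only [List.sum_append, List.sum_replicate, smul_zero, List.sum_cons, sum_expandWord,
      zero_add]
    rw [← mul_assoc, ← mul_inv, ← pow_succ']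

theorem invSuffixSums_expandWord_ofFn {n : ℕ} (w : Fin n → L) (f : Fin n → ℕ) :
    invSuffixSums (expandWord (List.ofFn fun i => (w i, f i))) = suffixInvProd w f := by
  induction n with
  | zero => simp [expandWord, invSuffixSums, suffixInvProd]
  | succ n ih =>
    rw [List.ofFn_succ, invSuffixSums_expandWord_cons, ih]
    conv_rhs => rw [← Fin.cons_self_tail f, suffixInvProd_cons, Fin.sum_univ_succ]
    rw [List.map_ofFn, List.sum_ofFn]
    rfl

/-- The function `linFormSeries` on words. -/
noncomputable def wordSeries (x : List (L × ℕ)) : L :=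
  linFormSeries (fun i => ((List.equivSigmaTuple x).2 i).1)
    (fun i => ((List.equivSigmaTuple x).2 i).2)

theorem wordSeries_ofFn {n : ℕ} (g : Fin n → L × ℕ) :
    wordSeries (List.ofFn g) = linFormSeries (fun i => (g i).1) (fun i => (g i).2) := by
  have h : List.equivSigmaTuple (List.ofFn g) = ⟨n, g⟩ :=
    List.equivSigmaTuple.apply_symm_apply ⟨n, g⟩
  unfold wordSeries
  rw [h]

theorem exists_ofFn_prod {α β : Type*} (x : List (α × β)) :
    ∃ (n : ℕ) (w : Fin n → α) (e : Fin n → β), x = List.ofFn fun i => (w i, e i) :=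
  ⟨x.length, fun i => (x.get i).1, fun i => (x.get i).2, by simp⟩

theorem wordSeries_mul (hP : (0 : L) ∉ P) (u v : List (L × ℕ)) (hu : ∀ p ∈ u, p.1 ∈ P)
    (hv : ∀ p ∈ v, p.1 ∈ P) :
    wordSeries u * wordSeries v = ((shuffle u v).map wordSeries).sum := by
  refine mul_eq_sum_shuffle_of_recurrence hP ?_ ?_ u v hu hv
  · have := wordSeries_ofFn (L := L) (n := 0) (fun i => i.elim0)
    rwa [List.ofFn_zero, linFormSeries_zero] at this
  · intro x hx hxP
    obtain ⟨n, w, e, rfl⟩ := exists_ofFn_prod x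
    rcases n with _ | n
    · simp at hx
    · have hs : ((List.ofFn fun i => (w i, e i)).map Prod.fst).sum = ∑ i, w i := by
        rw [List.map_ofFn, List.sum_ofFn]; rfl
      have h0 : ∑ i, w i ≠ 0 := by
        intro h
        refine hP (h ▸ hs ▸ list_sum_mem_of_ne_nil (fun c hc => ?_) (by simp))
        obtain ⟨q, hq, rfl⟩ := List.mem_map.1 hc
        exact hxP q hq
      rw [hs, wordSeries_ofFn, mul_linFormSeries w h0 e, decWords_ofFn]
      congr 1
      · have : ∀ s : Multiset (List (L × ℕ)), (s.map wordSeries).sum =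
            (Multiset.sumAddMonoidHom.comp (Multiset.mapAddMonoidHom wordSeries)) s := fun _ => rfl
        rw [this, map_sum]
        refine Finset.sum_congr rfl fun t _ => ?_
        split_ifs
        · simp
        · rw [AddMonoidHom.comp_apply, Multiset.coe_mapAddMonoidHom, Multiset.map_singleton,
            Multiset.coe_sumAddMonoidHom, Multiset.sum_singleton, wordSeries_ofFn]
      · rw [List.ofFn_succ, tailTerm, wordSeries_ofFn]
        rfl

end ExpandWord

/-! ### Linear independence of the fractions -/

section PrefixProd

/-- The product of the powers `(acc + a₁ + ⋯ + a_i)^{s_i}` for a word `(a₁, s₁) ⋯ (a_n, s_n)`. -/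
def prefixProd {R : Type*} [CommSemiring R] : R → List (R × ℕ+) → R
  | _, [] => 1
  | acc, p :: x => (acc + p.1) ^ (p.2 : ℕ) * prefixProd (acc + p.1) x

theorem map_prefixProd {R S : Type*} [CommSemiring R] [CommSemiring S] (f : R →+* S) (acc : R)
    (x : List (R × ℕ+)) :
    f (prefixProd acc x) = prefixProd (f acc) (x.map fun p => (f p.1, p.2)) := by
  induction x generalizing acc with
  | nil => simp [prefixProd]
  | cons p x ih => simp [prefixProd, ih]

theorem prefixProd_ofFn {R : Type*} [CommSemiring R] (acc : R) {n : ℕ} (w : Fin n → R)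
    (s : Fin n → ℕ+) :
    prefixProd acc (List.ofFn fun i => (w i, s i)) =
      ∏ i, (acc + ∑ k ∈ Finset.Iic i, w k) ^ (s i : ℕ) := by
  induction n generalizing acc with
  | zero => simp [prefixProd]
  | succ n ih =>
    rw [List.ofFn_succ, prefixProd, ih, Fin.prod_univ_succ]
    simp only [sum_Iic_zero_fin, sum_Iic_succ_fin, add_assoc]

variable (ι K : Type*) [Field K]

/-- The polynomials whose value at `(1, …, 1)` is a positive integer. -/
def posPoly : AddSubsemigroup (MvPolynomial ι K) where
  carrier := {p | ∃ k : ℕ, 0 < k ∧ MvPolynomial.eval (fun _ => 1) p = k}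
  add_mem' := by
    rintro p q ⟨k, hk, hp⟩ ⟨l, _, hq⟩
    exact ⟨k + l, by omega, by rw [map_add, hp, hq, Nat.cast_add]⟩

variable {ι K}

theorem X_mem_posPoly (i : ι) : MvPolynomial.X i ∈ posPoly ι K := ⟨1, one_pos, by simp⟩

variable [CharZero K]

theorem zero_notMem_posPoly : (0 : MvPolynomial ι K) ∉ posPoly ι K := by
  rintro ⟨k, hk, h⟩
  rw [map_zero] at h
  exact hk.ne (by exact_mod_cast h)

theorem prefixProd_ne_zero {acc : MvPolynomial ι K} {x : List (MvPolynomial ι K × ℕ+)}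
    (hacc : acc ∈ posPoly ι K) (hx : ∀ p ∈ x, p.1 = 0 ∨ p.1 ∈ posPoly ι K) :
    prefixProd acc x ≠ 0 := by
  induction x generalizing acc with
  | nil => exact one_ne_zero
  | cons p x ih =>
    have h : acc + p.1 ∈ posPoly ι K := by
      rcases hx p (by simp) with h | h
      · rwa [h, add_zero]
      · exact AddSubsemigroup.add_mem _ hacc h
    exact mul_ne_zero (pow_ne_zero _ fun h0 => zero_notMem_posPoly (h0 ▸ h))
      (ih h fun q hq => hx q (by simp [hq]))

theorem prefixProd_cons_ne_zero {acc : MvPolynomial ι K} {p : MvPolynomial ι K × ℕ+}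
    {x : List (MvPolynomial ι K × ℕ+)} (hp : acc + p.1 ∈ posPoly ι K)
    (hx : ∀ p ∈ x, p.1 = 0 ∨ p.1 ∈ posPoly ι K) : prefixProd acc (p :: x) ≠ 0 :=
  mul_ne_zero (pow_ne_zero _ fun h0 => zero_notMem_posPoly (h0 ▸ hp)) (prefixProd_ne_zero hp hx)

end PrefixProd

section Specialization

theorem sum_div_mul_prod {F ι : Type*} [Field F] [DecidableEq ι] (s : Finset ι) (N D : ι → F)
    (hD : ∀ i ∈ s, D i ≠ 0) :
    (∑ i ∈ s, N i / D i) * ∏ i ∈ s, D i = ∑ i ∈ s, N i * ∏ j ∈ s.erase i, D j := by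
  rw [Finset.sum_mul]
  refine Finset.sum_congr rfl fun i hi => ?_
  rw [← Finset.mul_prod_erase s D hi, ← mul_assoc, div_mul_cancel₀ _ (hD i hi)]

/-- A linear relation between fractions is preserved by a ring homomorphism which does not kill
the denominators. -/
theorem sum_div_map_eq_zero {A B F F' ι : Type*} [CommRing A] [CommRing B] [Field F] [Field F']
    [Algebra A F] [Algebra B F'] [FaithfulSMul A F] [FaithfulSMul B F']
    (e : A →+* B) (s : Finset ι) (N D : ι → A) (hD : ∀ i ∈ s, e (D i) ≠ 0)
    (h : ∑ i ∈ s, algebraMap A F (N i) / algebraMap A F (D i) = 0) :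
    ∑ i ∈ s, algebraMap B F' (e (N i)) / algebraMap B F' (e (D i)) = 0 := by
  classical
  have h1 := sum_div_mul_prod s (fun i => algebraMap A F (N i)) (fun i => algebraMap A F (D i))
    (fun i hi h0 => hD i hi (by
      rw [(FaithfulSMul.algebraMap_injective A F) (h0.trans (map_zero _).symm), map_zero]))
  rw [h, zero_mul] at h1
  have h2 : ∑ i ∈ s, N i * ∏ j ∈ s.erase i, D j = 0 := by
    refine FaithfulSMul.algebraMap_injective A F ?_
    rw [map_zero, h1]
    simp only [map_sum, map_mul, map_prod]
  have hD' : ∀ i ∈ s, algebraMap B F' (e (D i)) ≠ 0 := fun i hi h0 =>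
    hD i hi ((FaithfulSMul.algebraMap_injective B F') (h0.trans (map_zero _).symm))
  have h3 := sum_div_mul_prod s (fun i => algebraMap B F' (e (N i)))
    (fun i => algebraMap B F' (e (D i))) hD'
  have h4 := congrArg (fun p => algebraMap B F' (e p)) h2
  simp only [map_sum, map_mul, map_prod, map_zero] at h4
  rw [h4] at h3
  exact (mul_eq_zero.1 h3).resolve_right (Finset.prod_ne_zero_iff.2 hD')

end Specialization

section Independence

variable {ι K : Type*} [Field K]

/-- The word in the variables `X_i` corresponding to a word in the letters `i`. -/
noncomputable def varWord (x : List (ι × ℕ+)) : List (MvPolynomial ι K × ℕ+) :=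
  x.map fun p => (MvPolynomial.X p.1, p.2)

theorem varWord_pos (x : List (ι × ℕ+)) :
    ∀ p ∈ (varWord x : List (MvPolynomial ι K × ℕ+)), p.1 = 0 ∨ p.1 ∈ posPoly ι K := by
  intro p hp
  obtain ⟨q, -, rfl⟩ := List.mem_map.1 hp
  exact Or.inr (X_mem_posPoly _)

theorem prefixProd_zero_varWord_ne_zero [CharZero K] (x : List (ι × ℕ+)) :
    prefixProd 0 (varWord x : List (MvPolynomial ι K × ℕ+)) ≠ 0 := by
  rcases x with _ | ⟨p, x⟩
  · exact one_ne_zero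
  · exact prefixProd_cons_ne_zero (by rw [zero_add]; exact X_mem_posPoly _) (varWord_pos x)

variable [DecidableEq ι]

/-- The substitution `X_a = 0`. -/
noncomputable def killVar (a : ι) : MvPolynomial ι K →+* MvPolynomial ι K :=
  (MvPolynomial.aeval fun i => if i = a then 0 else MvPolynomial.X i :
    MvPolynomial ι K →ₐ[K] MvPolynomial ι K).toRingHom

theorem killVar_X (a i : ι) :
    killVar a (MvPolynomial.X i : MvPolynomial ι K) = if i = a then 0 else MvPolynomial.X i := by
  simp [killVar]

theorem killVar_C (a : ι) (r : K) : killVar a (MvPolynomial.C r) = MvPolynomial.C r := by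
  simp [killVar]

theorem map_killVar_varWord {a : ι} {x : List (ι × ℕ+)} (h : a ∉ x.map Prod.fst) :
    (varWord x).map (fun p => (killVar a p.1, p.2)) =
      (varWord x : List (MvPolynomial ι K × ℕ+)) := by
  rw [varWord, List.map_map]
  refine List.map_congr_left fun p hp => ?_
  have : p.1 ≠ a := by
    rintro rfl
    exact h (List.mem_map_of_mem hp)
  simp [killVar_X, this]

/-- The numerator of `c X_a^k z_x`, where `z_x` is the inverse of the product of the powers of the
prefix sums of `x`, after cancellation of a power of `X_a`. -/
noncomputable def polarNum (a : ι) (k : ℕ) (c : K) : List (ι × ℕ+) → MvPolynomial ι K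
  | [] => MvPolynomial.C c * MvPolynomial.X a ^ k
  | p :: _ => if p.1 = a then MvPolynomial.C c * MvPolynomial.X a ^ (k - p.2)
      else MvPolynomial.C c * MvPolynomial.X a ^ k

/-- The denominator of `c X_a^k z_x`, after cancellation of a power of `X_a`. -/
noncomputable def polarDen (a : ι) : List (ι × ℕ+) → MvPolynomial ι K
  | [] => 1
  | p :: x => if p.1 = a then prefixProd (MvPolynomial.X a) (varWord x)
      else prefixProd 0 (varWord (p :: x))

theorem polar_eq {F : Type*} [Field F] [Algebra (MvPolynomial ι K) F]
    [FaithfulSMul (MvPolynomial ι K) F] (a : ι) {k : ℕ} (c : K) {x : List (ι × ℕ+)}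
    (hk : ∀ p ∈ x.head?, (p.2 : ℕ) ≤ k) :
    algebraMap (MvPolynomial ι K) F (polarNum a k c x) /
        algebraMap (MvPolynomial ι K) F (polarDen a x) =
      algebraMap (MvPolynomial ι K) F (MvPolynomial.X a) ^ k *
        (algebraMap (MvPolynomial ι K) F (MvPolynomial.C c) *
          (algebraMap (MvPolynomial ι K) F (prefixProd 0 (varWord x)))⁻¹) := by
  have hX : algebraMap (MvPolynomial ι K) F (MvPolynomial.X a) ≠ 0 := fun h =>
    MvPolynomial.X_ne_zero a ((FaithfulSMul.algebraMap_injective _ F) (h.trans (map_zero _).symm))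
  rcases x with _ | ⟨p, x⟩
  · simp [polarNum, polarDen, varWord, prefixProd, mul_comm]
  · have hpk : (p.2 : ℕ) ≤ k := hk p (by simp)
    rw [polarNum, polarDen]
    split_ifs with h
    · subst h
      have : prefixProd 0 (varWord (p :: x) : List (MvPolynomial ι K × ℕ+)) =
          (MvPolynomial.X p.1 : MvPolynomial ι K) ^ (p.2 : ℕ) *
          prefixProd (MvPolynomial.X p.1) (varWord x) := by
        simp [varWord, prefixProd]
      rw [this, map_mul, map_mul, map_pow, map_pow, mul_inv, div_eq_mul_inv]
      conv_rhs => rw [← Nat.sub_add_cancel hpk, pow_add]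
      field_simp
    · rw [map_mul, map_pow, div_eq_mul_inv]
      ring

variable [CharZero K]

theorem killVar_prefixProd_ne_zero {a : ι} {p : ι × ℕ+} (hp : p.1 ≠ a) (x : List (ι × ℕ+)) :
    killVar a (prefixProd 0 (varWord (p :: x) : List (MvPolynomial ι K × ℕ+))) ≠ 0 := by
  rw [map_prefixProd, map_zero, varWord, List.map_cons, List.map_cons]
  refine prefixProd_cons_ne_zero ?_ ?_
  · rw [zero_add, killVar_X, if_neg hp]
    exact X_mem_posPoly _
  · intro q hq
    obtain ⟨r, hr, rfl⟩ := List.mem_map.1 hq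
    obtain ⟨t, -, rfl⟩ := List.mem_map.1 hr
    simp only [killVar_X]
    split_ifs
    · exact Or.inl rfl
    · exact Or.inr (X_mem_posPoly _)

theorem killVar_polarDen_ne_zero (a : ι) {x : List (ι × ℕ+)} (hx : (x.map Prod.fst).Nodup) :
    killVar a (polarDen a x : MvPolynomial ι K) ≠ 0 := by
  rcases x with _ | ⟨p, x⟩
  · simp [polarDen]
  · rw [polarDen]
    split_ifs with h
    · rw [List.map_cons, List.nodup_cons] at hx
      rw [map_prefixProd, map_killVar_varWord (h ▸ hx.1), killVar_X, if_pos rfl]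
      exact prefixProd_zero_varWord_ne_zero x
    · exact killVar_prefixProd_ne_zero h x

theorem coeff_eq_zero_of_sum_inv_prefixProd (n : ℕ) (S : Finset (List (ι × ℕ+)))
    (c : List (ι × ℕ+) → K) (hS : ∀ x ∈ S, x.length = n ∧ (x.map Prod.fst).Nodup)
    (h : ∑ x ∈ S, c x • (algebraMap (MvPolynomial ι K) (FractionRing (MvPolynomial ι K))
      (prefixProd 0 (varWord x)))⁻¹ = 0) :
    ∀ x ∈ S, c x = 0 := by
  classical
  have hsmul : ∀ (r : K) (f : FractionRing (MvPolynomial ι K)),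
      r • f = algebraMap (MvPolynomial ι K) _ (MvPolynomial.C r) * f := by
    intro r f
    rw [Algebra.smul_def, IsScalarTower.algebraMap_apply K (MvPolynomial ι K)]
    rfl
  induction n generalizing S c with
  | zero =>
    intro x hx
    obtain rfl : x = [] := List.length_eq_zero_iff.1 (hS x hx).1
    have hS' : S = {[]} := by
      ext y
      rw [Finset.mem_singleton]
      exact ⟨fun hy => List.length_eq_zero_iff.1 (hS y hy).1, fun hy => hy ▸ hx⟩
    rw [hS', Finset.sum_singleton] at h
    simpa [varWord, prefixProd] using h
  | succ n ih =>
    by_contra! hne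
    obtain ⟨x₁, hx₁, hcx₁⟩ := hne
    set S₀ := S.filter fun x => c x ≠ 0 with hS₀
    have hS₀ne : S₀.Nonempty := ⟨x₁, Finset.mem_filter.2 ⟨hx₁, hcx₁⟩⟩
    have hsum₀ : ∑ x ∈ S₀, c x • (algebraMap (MvPolynomial ι K)
        (FractionRing (MvPolynomial ι K)) (prefixProd 0 (varWord x)))⁻¹ = 0 := by
      rw [← h, hS₀, Finset.sum_filter]
      refine Finset.sum_congr rfl fun x _ => ?_
      split_ifs with hx
      · rfl
      · rw [not_not.1 hx, zero_smul]
    obtain ⟨x₀, hx₀, hmax⟩ := Finset.exists_max_image S₀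
      (fun x => (x.head?.elim 0 fun p => (p.2 : ℕ))) hS₀ne
    have hx₀S := Finset.mem_filter.1 hx₀
    obtain ⟨⟨a, k⟩, y₀, rfl⟩ : ∃ p y, x₀ = p :: y := by
      rcases x₀ with _ | ⟨p, y⟩
      · have := (hS _ hx₀S.1).1
        simp at this
      · exact ⟨p, y, rfl⟩
    have hle : ∀ x ∈ S₀, ∀ p ∈ x.head?, (p.2 : ℕ) ≤ k := by
      intro x hx p hp
      have := hmax x hx
      rw [Option.mem_def] at hp
      rw [hp] at this
      exact this
    have hrel : ∑ x ∈ S₀, algebraMap (MvPolynomial ι K) (FractionRing (MvPolynomial ι K))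
        (polarNum a k (c x) x) /
          algebraMap (MvPolynomial ι K) _ (polarDen a x) = 0 := by
      rw [Finset.sum_congr rfl fun x hx => polar_eq a (c x) (hle x hx), ← Finset.mul_sum]
      rw [Finset.sum_congr rfl fun x _ => (hsmul (c x) _).symm, hsum₀, mul_zero]
    have hspec := sum_div_map_eq_zero (F' := FractionRing (MvPolynomial ι K)) (killVar a) S₀
      (fun x => polarNum a k (c x) x) (fun x => polarDen a x)
      (fun x hx => killVar_polarDen_ne_zero a (hS x (Finset.mem_filter.1 hx).1).2) hrel
    set S₁ := S₀.filter fun x => x.head? = some (a, k) with hS₁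
    have hcons : ∀ x ∈ S₁, (a, k) :: x.tail = x := by
      intro x hx
      have := (Finset.mem_filter.1 hx).2
      exact List.cons_head?_tail this
    have hspec₁ : ∑ x ∈ S₁, c ((a, k) :: x.tail) • (algebraMap (MvPolynomial ι K)
        (FractionRing (MvPolynomial ι K)) (prefixProd 0 (varWord x.tail)))⁻¹ = 0 := by
      rw [← hspec, hS₁, Finset.sum_filter]
      refine Finset.sum_congr rfl fun x hx => ?_
      have hxS := hS x (Finset.mem_filter.1 hx).1
      rcases x with _ | ⟨⟨b, s⟩, y⟩
      · simp at hxS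
      · have hsk : (s : ℕ) ≤ k := hle _ hx (b, s) (by simp)
        have hnd := hxS.2
        rw [List.map_cons, List.nodup_cons] at hnd
        simp only [List.head?_cons, Option.some.injEq, Prod.mk.injEq, polarNum, polarDen,
          List.tail_cons]
        by_cases hba : b = a
        · subst hba
          by_cases hs : s = k
          · subst hs
            simp only [if_true, true_and, Nat.sub_self, pow_zero, mul_one, killVar_C]
            rw [map_prefixProd (killVar b), map_killVar_varWord hnd.1, killVar_X, if_pos rfl, hsmul,
              div_eq_mul_inv]
          · have hlt : (k : ℕ) - s ≠ 0 := by
              have : (s : ℕ) ≠ k := fun h => hs (PNat.coe_injective h)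
              omega
            simp only [if_true, true_and, hs, if_false, map_mul, map_pow, killVar_X,
              zero_pow hlt, mul_zero, map_zero, zero_div]
        · simp only [hba, if_false, false_and, map_mul, map_pow, killVar_X, if_true,
            zero_pow k.ne_zero, mul_zero, map_zero, zero_div]
    have hinj : Set.InjOn (List.tail : List (ι × ℕ+) → _) S₁ := by
      intro x hx y hy hxy
      rw [← hcons x hx, ← hcons y hy, hxy]
    have hS₁mem : ∀ x ∈ S₁, x ∈ S := fun x hx =>
      (Finset.mem_filter.1 (Finset.mem_filter.1 hx).1).1
    have := ih (S₁.image List.tail) (fun y => c ((a, k) :: y)) (by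
      intro y hy
      obtain ⟨x, hx, rfl⟩ := Finset.mem_image.1 hy
      obtain ⟨h1, h2⟩ := hS x (hS₁mem x hx)
      rw [← hcons x hx, List.map_cons, List.nodup_cons] at h2
      rw [← hcons x hx, List.length_cons] at h1
      exact ⟨by omega, h2.2⟩) (by rw [Finset.sum_image hinj]; exact hspec₁)
    exact hx₀S.2 (this y₀ (Finset.mem_image.2
      ⟨(a, k) :: y₀, Finset.mem_filter.2 ⟨hx₀, by simp⟩, rfl⟩))

end Independence

/-! ### Shuffles of the words `ε_{σ,J}` -/

section EpsWord

/-- The last letter of the word, if any, is nonzero. -/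
def LastNeZero : List ℕ → Prop
  | [] => True
  | a :: x => (x = [] → a ≠ 0) ∧ LastNeZero x

theorem lastNeZero_of_mem_shuffle : ∀ u v w : List ℕ, LastNeZero u → LastNeZero v →
    w ∈ shuffle u v → LastNeZero w
  | [], v, w, _, hv, h => by
    rw [shuffle_nil_left, Multiset.mem_singleton] at h
    exact h ▸ hv
  | a :: u, [], w, hu, _, h => by
    rw [shuffle_nil_right, Multiset.mem_singleton] at h
    exact h ▸ hu
  | a :: u, b :: v, w, hu, hv, h => by
    rw [shuffle_cons_cons, Multiset.mem_add, Multiset.mem_map, Multiset.mem_map] at h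
    rcases h with ⟨x, hx, rfl⟩ | ⟨x, hx, rfl⟩
    · refine ⟨?_, lastNeZero_of_mem_shuffle u (b :: v) x hu.2 hv hx⟩
      rintro rfl
      simpa using (perm_of_mem_shuffle _ _ _ hx).length_eq
    · refine ⟨?_, lastNeZero_of_mem_shuffle (a :: u) v x hu hv.2 hx⟩
      rintro rfl
      simpa using (perm_of_mem_shuffle _ _ _ hx).length_eq
termination_by u v => u.length + v.length

theorem lastNeZero_expandWord {x : List (ℕ × ℕ)} (hx : ∀ p ∈ x, p.1 ≠ 0) :
    LastNeZero (expandWord x) := by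
  induction x with
  | nil => trivial
  | cons p x ih =>
    rw [expandWord]
    induction p.2 with
    | zero => exact ⟨fun _ => hx p (by simp), ih fun q hq => hx q (by simp [hq])⟩
    | succ k ihk => exact ⟨fun h => absurd h (by simp), ihk⟩

/-- The inverse of `expandWord`; the first argument counts the zeros that precede the word. -/
def collapseWord : ℕ → List ℕ → List (ℕ × ℕ)
  | _, [] => []
  | k, a :: w => if a = 0 then collapseWord (k + 1) w else (a, k) :: collapseWord 0 w

theorem collapseWord_expandWord {x : List (ℕ × ℕ)} (hx : ∀ p ∈ x, p.1 ≠ 0) :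
    collapseWord 0 (expandWord x) = x := by
  induction x with
  | nil => rfl
  | cons p x ih =>
    have hk : ∀ k l, collapseWord l (List.replicate k 0 ++ p.1 :: expandWord x) =
        (p.1, l + k) :: x := by
      intro k
      induction k with
      | zero =>
        intro l
        simp [collapseWord, hx p, ih fun q hq => hx q (by simp [hq])]
      | succ k ihk =>
        intro l
        simp only [List.replicate_succ, List.cons_append, collapseWord, if_true, ihk]
        rw [add_assoc, add_comm 1 k]
    rw [expandWord, hk, zero_add]

theorem ne_zero_of_mem_collapseWord {k : ℕ} {w : List ℕ} {p : ℕ × ℕ}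
    (hp : p ∈ collapseWord k w) : p.1 ≠ 0 := by
  induction w generalizing k with
  | nil => simp [collapseWord] at hp
  | cons a w ih =>
    rw [collapseWord] at hp
    split_ifs at hp with h
    · exact ih hp
    · rcases List.mem_cons.1 hp with rfl | hp
      · exact h
      · exact ih hp

theorem expandWord_collapseWord {w : List ℕ} (hw : LastNeZero w) :
    expandWord (collapseWord 0 w) = w := by
  have key : ∀ (w : List ℕ) (k : ℕ), LastNeZero w → (w = [] → k = 0) →
      expandWord (collapseWord k w) = List.replicate k 0 ++ w := by
    intro w
    induction w with
    | nil =>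
      intro k _ hk
      rw [hk rfl]
      rfl
    | cons a w ih =>
      intro k hw _
      rw [collapseWord]
      split_ifs with h
      · subst h
        rw [ih (k + 1) hw.2 fun h0 => absurd rfl (hw.1 h0), List.replicate_succ',
          List.append_assoc]
        rfl
      · rw [expandWord, ih 0 hw.2 fun _ => rfl]
        rfl
  exact key w 0 hw fun _ => rfl

theorem filter_expandWord {x : List (ℕ × ℕ)} (hx : ∀ p ∈ x, p.1 ≠ 0) :
    (expandWord x).filter (· ≠ 0) = x.map Prod.fst := by
  induction x with
  | nil => rfl
  | cons p x ih =>
    have hp := hx p (by simp)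
    have hi := ih fun q hq => hx q (by simp [hq])
    rw [expandWord, List.filter_append, List.filter_replicate]
    simpa [hp] using hi

theorem length_expandWord {α : Type*} [Zero α] (x : List (α × ℕ)) :
    (expandWord x).length = (x.map fun p => p.2 + 1).sum := by
  induction x with
  | nil => rfl
  | cons p x ih =>
    simp only [expandWord, List.length_append, List.length_replicate, List.length_cons, ih,
      List.map_cons, List.sum_cons]
    omega

/-- The word of the letters `(a, c - 1)` corresponding to a coloured word. -/
def predWord {α : Type*} (x : List (α × ℕ+)) : List (α × ℕ) := x.map fun p => (p.1, (p.2 : ℕ) - 1)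

theorem predWord_injective {α : Type*} : Function.Injective (predWord (α := α)) := by
  refine List.map_injective_iff.2 fun p q h => ?_
  obtain ⟨h1, h2⟩ := Prod.mk.inj h
  have := p.2.pos
  have := q.2.pos
  exact Prod.ext h1 (PNat.coe_injective (by omega))

theorem epsWord_eq_expandWord (m : ℕ) {n : ℕ} (σ : Equiv.Perm (Fin n)) (J : Fin n → ℕ+) :
    epsWord m σ J = expandWord (predWord (colWord m σ J)) := by
  have h : ∀ x : List (ℕ × ℕ),
      expandWord x = (x.map fun p => List.replicate p.2 0 ++ [p.1]).flatten := by
    intro x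
    induction x with
    | nil => rfl
    | cons p x ih => simp [expandWord, ih]
  rw [h, epsWord, predWord, colWord, List.map_ofFn, List.map_ofFn]
  rfl

theorem ne_zero_of_mem_predWord_colWord {m n : ℕ} {σ : Equiv.Perm (Fin n)} {J : Fin n → ℕ+} :
    ∀ p ∈ predWord (colWord m σ J), p.1 ≠ 0 := by
  intro p hp
  obtain ⟨q, hq, rfl⟩ := List.mem_map.1 hp
  obtain ⟨i, rfl⟩ := (List.mem_ofFn' _ _).1 hq
  simp

theorem length_epsWord (m : ℕ) {n : ℕ} (σ : Equiv.Perm (Fin n)) (J : Fin n → ℕ+) :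
    (epsWord m σ J).length = compWeight J := by
  rw [epsWord_eq_expandWord, length_expandWord, predWord, List.map_map, ← sum_map_snd_colWord m σ]
  refine congrArg _ (List.map_congr_left fun p _ => ?_)
  exact Nat.sub_add_cancel p.2.pos

theorem epsWord_injective {n : ℕ} :
    Function.Injective fun a : Equiv.Perm (Fin n) × (Fin n → ℕ+) => epsWord 0 a.1 a.2 := by
  intro a b h
  simp only [epsWord_eq_expandWord] at h
  have h1 := congrArg (collapseWord 0) h
  rw [collapseWord_expandWord ne_zero_of_mem_predWord_colWord,
    collapseWord_expandWord ne_zero_of_mem_predWord_colWord] at h1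
  have h2 := @colWord_injective ⟨n, a⟩ ⟨n, b⟩ (predWord_injective h1)
  simpa using h2

theorem mem_shuffle_epsWord {m n : ℕ} (σ' : Equiv.Perm (Fin m)) (J' : Fin m → ℕ+)
    (σ'' : Equiv.Perm (Fin n)) (J'' : Fin n → ℕ+) (w : List ℕ)
    (hw : w ∈ shuffle (epsWord 0 σ' J') (epsWord m σ'' J'')) :
    ∃ (σ : Equiv.Perm (Fin (m + n))) (J : Fin (m + n) → ℕ+),
      compWeight J = compWeight J' + compWeight J'' ∧ epsWord 0 σ J = w := by
  have hlast : LastNeZero w := by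
    refine lastNeZero_of_mem_shuffle _ _ w ?_ ?_ hw <;>
    · rw [epsWord_eq_expandWord]
      exact lastNeZero_expandWord ne_zero_of_mem_predWord_colWord
  have hperm := perm_of_mem_shuffle _ _ _ hw
  let x : List (ℕ × ℕ+) := (collapseWord 0 w).map fun p => (p.1, p.2.succPNat)
  have hx : predWord x = collapseWord 0 w := by
    simp only [x, predWord, List.map_map]
    refine (List.map_congr_left fun p _ => ?_).trans (List.map_id _)
    simp
  have hxw : expandWord (predWord x) = w := by rw [hx, expandWord_collapseWord hlast]
  have hfst : ∀ y : List (ℕ × ℕ+), (predWord y).map Prod.fst = y.map Prod.fst := fun y => by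
    simp [predWord, Function.comp_def]
  have h1 : (x.map Prod.fst).Perm ((List.range (m + n)).map (· + 1)) := by
    have h2 := hperm.filter (· ≠ 0)
    rw [← hxw, List.filter_append, epsWord_eq_expandWord, epsWord_eq_expandWord,
      filter_expandWord (by rw [hx]; exact fun p => ne_zero_of_mem_collapseWord),
      filter_expandWord ne_zero_of_mem_predWord_colWord,
      filter_expandWord ne_zero_of_mem_predWord_colWord, hfst, hfst, hfst] at h2
    refine h2.trans ?_
    rw [List.range_add, List.map_append]
    refine (perm_map_fst_colWord _ _ _).append ((perm_map_fst_colWord _ _ _).trans ?_)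
    rw [List.map_map]
    refine List.Perm.of_eq (List.map_congr_left fun x _ => ?_)
    simp only [Function.comp_apply]
    omega
  obtain ⟨σ, J, h⟩ := exists_colWord_eq x h1
  have hw' : epsWord 0 σ J = w := by rw [epsWord_eq_expandWord, h, hxw]
  refine ⟨σ, J, ?_, hw'⟩
  rw [← length_epsWord 0 σ J, hw', hperm.length_eq, List.length_append, length_epsWord,
    length_epsWord]

/-- Reindexing of a sum over a multiset along an injective parametrization of its support. -/
theorem sum_count_smul {K V W ι : Type*} [Semiring K] [AddCommMonoid V] [Module K V]
    [DecidableEq W] (T : Finset ι) (h : ι → W) (hinj : Set.InjOn h T) (s : Multiset W)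
    (hs : ∀ w ∈ s, ∃ i ∈ T, h i = w) (g : W → V) :
    ∑ i ∈ T, ((s.count (h i) : ℕ) : K) • g (h i) = (s.map g).sum := by
  classical
  rw [Finset.sum_multiset_map_count, ← Finset.sum_image (f := fun w => ((s.count w : ℕ) : K) • g w)
    hinj]
  simp only [Nat.cast_smul_eq_nsmul]
  symm
  refine Finset.sum_subset ?_ ?_
  · intro w hw
    exact Finset.mem_image.2 (hs w (Multiset.mem_toFinset.1 hw))
  · intro w _ hw
    rw [Multiset.mem_toFinset] at hw
    rw [Multiset.count_eq_zero_of_notMem hw, zero_smul]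

theorem sum_count_epsWord {K V : Type*} [Semiring K] [AddCommMonoid V] [Module K V] {m n : ℕ}
    (σ' : Equiv.Perm (Fin m)) (J' : Fin m → ℕ+) (σ'' : Equiv.Perm (Fin n)) (J'' : Fin n → ℕ+)
    (g : List ℕ → V) :
    ∑ σ : Equiv.Perm (Fin (m + n)), ∑ J ∈ compsOf (m + n) (compWeight J' + compWeight J''),
      (((shuffle (epsWord 0 σ' J') (epsWord m σ'' J'')).count (epsWord 0 σ J) : ℕ) : K) •
        g (epsWord 0 σ J) =
      ((shuffle (epsWord 0 σ' J') (epsWord m σ'' J'')).map g).sum := by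
  rw [← Finset.sum_product']
  refine sum_count_smul _ (fun a : Equiv.Perm (Fin (m + n)) × (Fin (m + n) → ℕ+) =>
    epsWord 0 a.1 a.2) epsWord_injective.injOn _ (fun w hw => ?_) g
  obtain ⟨σ, J, h1, h2⟩ := mem_shuffle_epsWord σ' J' σ'' J'' w hw
  exact ⟨(σ, J), by simp [mem_compsOf, h1], h2⟩

theorem sum_count_colWord {K V : Type*} [Semiring K] [AddCommMonoid V] [Module K V] {m n : ℕ}
    (σ' : Equiv.Perm (Fin m)) (J' : Fin m → ℕ+) (σ'' : Equiv.Perm (Fin n)) (J'' : Fin n → ℕ+)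
    (g : List (ℕ × ℕ+) → V) :
    ∑ σ : Equiv.Perm (Fin (m + n)), ∑ J ∈ compsOf (m + n) (compWeight J' + compWeight J''),
      (((shuffle (colWord 0 σ' J') (colWord m σ'' J'')).count (colWord 0 σ J) : ℕ) : K) •
        g (colWord 0 σ J) =
      ((shuffle (colWord 0 σ' J') (colWord m σ'' J'')).map g).sum := by
  rw [← Finset.sum_product']
  refine sum_count_smul _ (fun a : Equiv.Perm (Fin (m + n)) × (Fin (m + n) → ℕ+) =>
    colWord 0 a.1 a.2) ?_ _ (fun w hw => ?_) g
  · intro a _ b _ h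
    have := @colWord_injective ⟨_, a⟩ ⟨_, b⟩ h
    simpa using this
  · obtain ⟨σ, J, h1, h2⟩ := mem_shuffle_colWord ⟨m, σ', J'⟩ ⟨n, σ'', J''⟩ w hw
    exact ⟨(σ, J), by simp [mem_compsOf, h1], h2⟩

end EpsWord

/-! ### The fractions as functions of words -/

namespace RatFn

variable (K : Type*) [Field K]

/-- The variable `u_a` for `1 ≤ a ≤ n`, and zero for the other letters `a`. -/
noncomputable def letterVar (n a : ℕ) : RatFn K n :=
  if h : 0 < a ∧ a - 1 < n then var K ⟨a - 1, h.2⟩ else 0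

theorem letterVar_zero (n : ℕ) : letterVar K n 0 = 0 := dif_neg fun h => h.1.false

theorem letterVar_succ {n : ℕ} (i : Fin n) : letterVar K n (i + 1) = var K i :=
  dif_pos (c := 0 < (i : ℕ) + 1 ∧ (i : ℕ) + 1 - 1 < n) ⟨Nat.succ_pos _, i.2⟩

/-- The word of rational functions corresponding to a coloured word. -/
noncomputable def letterWord (n : ℕ) (x : List (ℕ × ℕ+)) : List (RatFn K n × ℕ) :=
  (predWord x).map fun p => (letterVar K n p.1, p.2)

theorem subst_var {p n : ℕ} (e : Fin p ↪ Fin n) (i : Fin p) :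
    subst K e (var K i) = var K (e i) := by
  rw [var, subst_algebraMap, MvPolynomial.rename_X, var]

theorem letterWord_colWord_zero {n : ℕ} (N : ℕ) (e : Fin n ↪ Fin N) (m : ℕ)
    (he : ∀ i, (e i : ℕ) = i + m) (σ : Equiv.Perm (Fin n)) (c : Fin n → ℕ+) :
    letterWord K N (colWord m σ c) =
      List.ofFn fun i => (subst K e (var K (σ i)), (c i : ℕ) - 1) := by
  simp only [letterWord, predWord, colWord, List.map_ofFn, Function.comp_def]
  congr 1
  funext i
  rw [subst_var, ← letterVar_succ, he]
  congr 2
  omega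

theorem zFrac_reverse {n : ℕ} (σ : Equiv.Perm (Fin n)) (J : Fin n → ℕ+) :
    zFrac K (Fin.revPerm.trans σ) (J ∘ Fin.rev) =
      suffixInvProd (fun i => var K (σ i)) (fun i => (J i : ℕ) - 1) := by
  rw [zFrac, suffixInvProd, Finset.prod_inv_distrib]
  congr 1
  refine Fintype.prod_equiv Fin.revPerm _ _ fun i => ?_
  rw [Nat.sub_add_cancel (J _).pos]
  congr 1
  refine Finset.sum_equiv Fin.revPerm (fun k => ?_) fun k _ => rfl
  simp

theorem map_suffixInvProd {L L' : Type*} [Field L] [Field L'] (f : L →+* L') {n : ℕ}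
    (w : Fin n → L) (e : Fin n → ℕ) :
    f (suffixInvProd w e) = suffixInvProd (fun i => f (w i)) e := by
  simp [suffixInvProd]

theorem map_linFormSeries {L L' : Type*} [Field L] [Field L'] (f : L →+* L') {n : ℕ}
    (w : Fin n → L) (e : Fin n → ℕ) :
    f (linFormSeries w e) = linFormSeries (fun i => f (w i)) e := by
  simp [linFormSeries, map_suffixInvProd]

theorem sum_setPartCoeff_smul_zFrac {n : ℕ} (σ : Equiv.Perm (Fin n)) (I : Fin n → ℕ+) :
    ∑ J ∈ compsOf n (compWeight I), (setPartCoeff I J : K) •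
        zFrac K (Fin.revPerm.trans σ) (J ∘ Fin.rev) =
      linFormSeries (fun i => var K (σ i)) (fun i => (I i : ℕ) - 1) := by
  have hw : ∀ J : Fin n → ℕ+, compWeight J = ∑ i, ((J i : ℕ) - 1) + n := by
    intro J
    have : compWeight J = ∑ i, (((J i : ℕ) - 1) + 1) :=
      Finset.sum_congr rfl fun i _ => (Nat.sub_add_cancel (J i).pos).symm
    rw [this, Finset.sum_add_distrib]
    simp
  rw [linFormSeries]
  refine Finset.sum_nbij' (fun J i => (J i : ℕ) - 1) (fun f i => (f i).succPNat) ?_ ?_ ?_ ?_ ?_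
  · intro J hJ
    rw [mem_compsOf, hw, hw I] at hJ
    rw [Finset.Nat.mem_antidiagonalTuple]
    omega
  · intro f hf
    rw [Finset.Nat.mem_antidiagonalTuple] at hf
    rw [mem_compsOf, hw, hw I]
    simp [hf]
  · intro J _
    funext i
    exact PNat.coe_injective (Nat.sub_add_cancel (J i).pos)
  · intro f _
    funext i
    simp
  · intro J hJ
    rw [← setPartCoeff_eq_linFormCoeff (mem_compsOf.1 hJ).symm, ← zFrac_reverse, Algebra.smul_def]
    simp

section Positivity

/-- The image in the field of fractions of the polynomials whose value at `(1, …, 1)` is a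
positive integer. -/
noncomputable def posRat (n : ℕ) : AddSubsemigroup (RatFn K n) :=
  (posPoly (Fin n) K).map
    ((algebraMap (MvPolynomial (Fin n) K) (RatFn K n)).toAddMonoidHom : AddHom _ _)

variable {K}

theorem var_mem_posRat {n : ℕ} (i : Fin n) : var K i ∈ posRat K n :=
  ⟨MvPolynomial.X i, X_mem_posPoly i, rfl⟩

theorem letterWord_mem_posRat {n N : ℕ} (e : Fin n ↪ Fin N) {m : ℕ}
    (he : ∀ i, (e i : ℕ) = i + m) (σ : Equiv.Perm (Fin n)) (c : Fin n → ℕ+) :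
    ∀ p ∈ letterWord K N (colWord m σ c), p.1 ∈ posRat K N := by
  rw [letterWord_colWord_zero K N e m he]
  intro p hp
  obtain ⟨i, rfl⟩ := (List.mem_ofFn' _ _).1 hp
  simp only [subst_var]
  exact var_mem_posRat _

theorem zero_notMem_posRat [CharZero K] (n : ℕ) : (0 : RatFn K n) ∉ posRat K n := by
  rintro ⟨p, hp, h⟩
  have : p = 0 := IsFractionRing.injective (MvPolynomial (Fin n) K) (RatFn K n)
    (h.trans (map_zero _).symm)
  exact zero_notMem_posPoly (this ▸ hp)

end Positivity

theorem castAddEmb_val {m n : ℕ} (i : Fin m) : (Fin.castAddEmb n i : ℕ) = i + 0 := by simp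

theorem natAddEmb_val {m n : ℕ} (i : Fin n) : (Fin.natAddEmb m i : ℕ) = i + m := by
  simp [add_comm]

theorem refl_val {n : ℕ} (i : Fin n) : (Function.Embedding.refl _ i : ℕ) = i + 0 := rfl

theorem letterWord_colWord {n : ℕ} (σ : Equiv.Perm (Fin n)) (c : Fin n → ℕ+) :
    letterWord K n (colWord 0 σ c) = List.ofFn fun i => (var K (σ i), (c i : ℕ) - 1) := by
  simp only [letterWord_colWord_zero K n (Function.Embedding.refl _) 0 refl_val, subst_var,
    Function.Embedding.refl_apply]

theorem shuffle_letterWord (n : ℕ) (u v : List (ℕ × ℕ+)) :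
    shuffle (letterWord K n u) (letterWord K n v) = (shuffle u v).map (letterWord K n) := by
  have h : letterWord K n = List.map fun p => (letterVar K n p.1, (p.2 : ℕ) - 1) := by
    funext x
    simp [letterWord, predWord, Function.comp_def]
  rw [h, shuffle_map]

theorem map_letterVar_epsWord (N m : ℕ) {n : ℕ} (σ : Equiv.Perm (Fin n)) (J : Fin n → ℕ+) :
    (epsWord m σ J).map (letterVar K N) = expandWord (letterWord K N (colWord m σ J)) := by
  rw [epsWord_eq_expandWord, map_expandWord _ (letterVar_zero K N)]
  rfl

theorem invSuffixSums_epsWord {n : ℕ} (σ : Equiv.Perm (Fin n)) (J : Fin n → ℕ+) :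
    invSuffixSums ((epsWord 0 σ J).map (letterVar K n)) =
      zFrac K (Fin.revPerm.trans σ) (J ∘ Fin.rev) := by
  rw [map_letterVar_epsWord, letterWord_colWord, invSuffixSums_expandWord_ofFn, zFrac_reverse]

/-- The product rule for the fractions `z_{σ,J}`, read from right to left. -/
theorem mu_zFrac [CharZero K] {m n : ℕ} (σ' : Equiv.Perm (Fin m)) (J' : Fin m → ℕ+)
    (σ'' : Equiv.Perm (Fin n)) (J'' : Fin n → ℕ+) :
    mu K (zFrac K (Fin.revPerm.trans σ') (J' ∘ Fin.rev))
        (zFrac K (Fin.revPerm.trans σ'') (J'' ∘ Fin.rev)) =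
      ∑ σ : Equiv.Perm (Fin (m + n)), ∑ J ∈ compsOf (m + n) (compWeight J' + compWeight J''),
        (((shuffle (epsWord 0 σ' J') (epsWord m σ'' J'')).count (epsWord 0 σ J) : ℕ) : K) •
          zFrac K (Fin.revPerm.trans σ) (J ∘ Fin.rev) := by
  simp only [← invSuffixSums_epsWord K (n := m + n)]
  rw [sum_count_epsWord σ' J' σ'' J''
    (fun w => invSuffixSums (w.map (letterVar K (m + n))))]
  have h1 : ∀ s : Multiset (List ℕ),
      (s.map fun w => invSuffixSums (w.map (letterVar K (m + n)))).sum =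
        ((s.map (List.map (letterVar K (m + n)))).map invSuffixSums).sum := fun s => by
    rw [Multiset.map_map]
    rfl
  rw [h1, ← shuffle_map, map_letterVar_epsWord, map_letterVar_epsWord,
    ← invSuffixSums_mul (zero_notMem_posRat (m + n)) _ _
      (suffix_sum_expandWord_mem (letterWord_mem_posRat (Fin.castAddEmb n) castAddEmb_val σ' J'))
      (suffix_sum_expandWord_mem (letterWord_mem_posRat (Fin.natAddEmb m) natAddEmb_val σ'' J'')),
    letterWord_colWord_zero K _ (Fin.castAddEmb n) 0 castAddEmb_val,
    letterWord_colWord_zero K _ (Fin.natAddEmb m) m natAddEmb_val,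
    invSuffixSums_expandWord_ofFn, invSuffixSums_expandWord_ofFn, zFrac_reverse, zFrac_reverse,
    mu, map_suffixInvProd, map_suffixInvProd]

theorem wordSeries_letterWord {n : ℕ} (σ : Equiv.Perm (Fin n)) (c : Fin n → ℕ+) :
    wordSeries (letterWord K n (colWord 0 σ c)) =
      linFormSeries (fun i => var K (σ i)) (fun i => (c i : ℕ) - 1) := by
  rw [letterWord_colWord, wordSeries_ofFn]

theorem mu_linFormSeries [CharZero K] {m n : ℕ} (σ' : Equiv.Perm (Fin m)) (c' : Fin m → ℕ+)
    (σ'' : Equiv.Perm (Fin n)) (c'' : Fin n → ℕ+) :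
    mu K (linFormSeries (fun i => var K (σ' i)) (fun i => (c' i : ℕ) - 1))
        (linFormSeries (fun i => var K (σ'' i)) (fun i => (c'' i : ℕ) - 1)) =
      ∑ σ : Equiv.Perm (Fin (m + n)), ∑ c ∈ compsOf (m + n) (compWeight c' + compWeight c''),
        (((shuffle (colWord 0 σ' c') (colWord m σ'' c'')).count (colWord 0 σ c) : ℕ) : K) •
          linFormSeries (fun i => var K (σ i)) (fun i => (c i : ℕ) - 1) := by
  simp only [← wordSeries_letterWord K (n := m + n)]
  rw [sum_count_colWord σ' c' σ'' c'' (fun x => wordSeries (letterWord K (m + n) x))]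
  have h1 : ∀ s : Multiset (List (ℕ × ℕ+)),
      (s.map fun x => wordSeries (letterWord K (m + n) x)).sum =
        ((s.map (letterWord K (m + n))).map wordSeries).sum := fun s => by
    rw [Multiset.map_map]
    rfl
  rw [h1, ← shuffle_letterWord, ← wordSeries_mul (zero_notMem_posRat (m + n)) _ _
      (letterWord_mem_posRat (Fin.castAddEmb n) castAddEmb_val σ' c')
      (letterWord_mem_posRat (Fin.natAddEmb m) natAddEmb_val σ'' c''),
    letterWord_colWord_zero K _ (Fin.castAddEmb n) 0 castAddEmb_val,
    letterWord_colWord_zero K _ (Fin.natAddEmb m) m natAddEmb_val,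
    wordSeries_ofFn, wordSeries_ofFn, mu, map_linFormSeries, map_linFormSeries]

theorem zFrac_eq_inv_prefixProd {n : ℕ} (σ : Equiv.Perm (Fin n)) (s : Fin n → ℕ+) :
    zFrac K σ s = (algebraMap (MvPolynomial (Fin n) K) (RatFn K n)
      (prefixProd 0 (varWord (List.ofFn fun i => (σ i, s i)))))⁻¹ := by
  have h : (varWord (List.ofFn fun i => (σ i, s i)) : List (MvPolynomial (Fin n) K × ℕ+)) =
      List.ofFn fun i => (MvPolynomial.X (σ i), s i) := by
    rw [varWord, List.map_ofFn]
    rfl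
  rw [h, prefixProd_ofFn, zFrac]
  simp only [zero_add, map_prod, map_pow, map_sum, var]

theorem linearIndependent_zFrac [CharZero K] (n : ℕ) :
    LinearIndependent K fun a : Equiv.Perm (Fin n) × (Fin n → ℕ+) => zFrac K a.1 a.2 := by
  classical
  let w : Equiv.Perm (Fin n) × (Fin n → ℕ+) → List (Fin n × ℕ+) :=
    fun a => List.ofFn fun i => (a.1 i, a.2 i)
  have hw : Function.Injective w := by
    intro a b h
    have h' := List.ofFn_injective h
    refine Prod.ext (Equiv.ext fun i => congrArg Prod.fst (congrFun h' i))
      (funext fun i => congrArg Prod.snd (congrFun h' i))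
  rw [linearIndependent_iff']
  intro S c h a ha
  have key := coeff_eq_zero_of_sum_inv_prefixProd (K := K) n (S.image w)
    (fun x => c (Function.invFun w x)) ?_ ?_ (w a) (Finset.mem_image_of_mem w ha)
  · rwa [Function.leftInverse_invFun hw] at key
  · intro x hx
    obtain ⟨b, -, rfl⟩ := Finset.mem_image.1 hx
    refine ⟨List.length_ofFn, ?_⟩
    rw [List.map_ofFn]
    exact List.nodup_ofFn.2 b.1.injective
  · rw [Finset.sum_image hw.injOn, ← h]
    refine Finset.sum_congr rfl fun b _ => ?_
    rw [Function.leftInverse_invFun hw, zFrac_eq_inv_prefixProd]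

end RatFn

/-! ### The basis `Z` and the realization by rational moulds -/

namespace FQSymCol

variable (K : Type*) [Field K]

/-- The basis of the elements `F_{σ,c}`. -/
noncomputable def basisF : Module.Basis ColPerm K (FQSymCol K) :=
  Module.Basis.ofRepr (LinearEquiv.refl K (ColPerm →₀ K))

theorem basisF_apply {n : ℕ} (σ : Equiv.Perm (Fin n)) (c : Fin n → ℕ+) :
    basisF K ⟨n, σ, c⟩ = F K σ c := rfl

/-- The linear endomorphism `F_{σ,I} ↦ ∑_J c_{IJ} F_{σ,J}`. -/
noncomputable def transition : FQSymCol K →ₗ[K] FQSymCol K :=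
  (basisF K).constr K fun a =>
    ∑ J ∈ compsOf a.1 (compWeight a.2.2), (setPartCoeff a.2.2 J : K) • F K a.2.1 J

theorem transition_F {n : ℕ} (σ : Equiv.Perm (Fin n)) (I : Fin n → ℕ+) :
    transition K (F K σ I) =
      ∑ J ∈ compsOf n (compWeight I), (setPartCoeff I J : K) • F K σ J := by
  rw [← basisF_apply, transition, Module.Basis.constr_basis]

theorem F_mem_range_transition {n : ℕ} (σ : Equiv.Perm (Fin n)) (I : Fin n → ℕ+) :
    F K σ I ∈ LinearMap.range (transition K) := by
  classical
  by_contra hI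
  obtain ⟨M, hM, hmax⟩ := Finset.exists_max_image
    ((compsOf n (compWeight I)).filter fun J => F K σ J ∉ LinearMap.range (transition K))
    toLex ⟨I, Finset.mem_filter.2 ⟨mem_compsOf.2 rfl, hI⟩⟩
  obtain ⟨hMw, hMF⟩ := Finset.mem_filter.1 hM
  refine hMF ?_
  have hT := transition_F K σ M
  rw [← Finset.add_sum_erase _ _ (mem_compsOf.2 rfl : M ∈ compsOf n (compWeight M)),
    setPartCoeff_self, Nat.cast_one, one_smul] at hT
  rw [eq_sub_of_add_eq hT.symm]
  refine Submodule.sub_mem _ (LinearMap.mem_range_self _ _) (Submodule.sum_mem _ fun J hJ => ?_)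
  obtain ⟨hJM, hJw⟩ := Finset.mem_erase.1 hJ
  rw [mem_compsOf] at hJw hMw
  by_cases hc : setPartCoeff M J = 0
  · rw [hc, Nat.cast_zero, zero_smul]
    exact Submodule.zero_mem _
  · refine Submodule.smul_mem _ _ ?_
    by_contra hJF
    have h1 := toLex_le_of_setPartCoeff_ne_zero hJw.symm hc
    have h2 := hmax J (Finset.mem_filter.2 ⟨mem_compsOf.2 (hJw.trans hMw), hJF⟩)
    exact hJM (toLex.injective (le_antisymm h2 h1))

theorem repr_transition_F {n : ℕ} (σ : Equiv.Perm (Fin n)) (I : Fin n → ℕ+) (b : ColPerm) :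
    (basisF K).repr (transition K (F K σ I)) b =
      ∑ J ∈ compsOf n (compWeight I),
        (setPartCoeff I J : K) * (Finsupp.single ⟨n, σ, J⟩ 1 : ColPerm →₀ K) b := by
  rw [transition_F, map_sum, Finsupp.coe_finsetSum, Finset.sum_apply]
  refine Finset.sum_congr rfl fun J _ => ?_
  rw [map_smul, ← basisF_apply, Module.Basis.repr_self, Finsupp.smul_apply, smul_eq_mul]

theorem repr_transition_F_eq_ite {n : ℕ} (σ τ : Equiv.Perm (Fin n)) (I M : Fin n → ℕ+) :
    (basisF K).repr (transition K (F K σ I)) ⟨n, τ, M⟩ =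
      if σ = τ ∧ compWeight M = compWeight I then (setPartCoeff I M : K) else 0 := by
  classical
  simp only [repr_transition_F, Finsupp.single_apply, Sigma.mk.injEq, heq_eq_eq, true_and,
    Prod.mk.injEq, mul_ite, mul_one, mul_zero]
  split_ifs with h
  · rw [Finset.sum_eq_single_of_mem M (mem_compsOf.2 h.2), if_pos ⟨h.1, rfl⟩]
    exact fun J _ hJ => if_neg fun h' => hJ h'.2
  · refine Finset.sum_eq_zero fun J hJ => if_neg fun h' => h ⟨h'.1, ?_⟩
    rw [← h'.2]
    exact mem_compsOf.1 hJ

theorem transition_injective : Function.Injective (transition K) := by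
  classical
  rw [injective_iff_map_eq_zero]
  intro x hx
  by_contra hne
  have hsupp : ((basisF K).repr x).support.Nonempty := by
    rw [Finsupp.support_nonempty_iff]
    simpa using hne
  obtain ⟨⟨n, σ, I⟩, hI⟩ := hsupp
  let S : Finset (Fin n → ℕ+) := (compsOf n (compWeight I)).filter fun J =>
    (basisF K).repr x ⟨n, σ, J⟩ ≠ 0
  obtain ⟨M, hM, hmin⟩ := Finset.exists_min_image S toLex
    ⟨I, Finset.mem_filter.2 ⟨mem_compsOf.2 rfl, Finsupp.mem_support_iff.1 hI⟩⟩
  obtain ⟨hMw, hMx⟩ := Finset.mem_filter.1 hM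
  refine hMx ?_
  have h0 : (basisF K).repr (transition K x) ⟨n, σ, M⟩ = 0 := by rw [hx]; simp
  rw [← (basisF K).linearCombination_repr x, Finsupp.linearCombination_apply, Finsupp.sum,
    map_sum, map_sum, Finsupp.coe_finsetSum, Finset.sum_apply,
    Finset.sum_eq_single_of_mem ⟨n, σ, M⟩ (Finsupp.mem_support_iff.2 hMx)] at h0
  · rw [basisF_apply, map_smul, map_smul, Finsupp.smul_apply, repr_transition_F_eq_ite,
      if_pos ⟨rfl, rfl⟩, setPartCoeff_self, Nat.cast_one, smul_eq_mul, mul_one] at h0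
    exact h0
  · rintro ⟨k, τ, J⟩ hJ hJM
    rw [basisF_apply, map_smul, map_smul, Finsupp.smul_apply]
    by_cases hkn : k = n
    · subst hkn
      rw [repr_transition_F_eq_ite]
      split_ifs with h
      · obtain ⟨rfl, hw⟩ := h
        by_cases hc : setPartCoeff J M = 0
        · rw [hc, Nat.cast_zero, smul_zero]
        · have h1 := toLex_le_of_setPartCoeff_ne_zero hw.symm hc
          have h2 := hmin J (Finset.mem_filter.2
            ⟨mem_compsOf.2 (hw.symm.trans (mem_compsOf.1 hMw)), Finsupp.mem_support_iff.1 hJ⟩)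
          exact absurd (by rw [toLex.injective (le_antisymm h1 h2)]) hJM
      · exact smul_zero _
    · rw [repr_transition_F, Finset.sum_eq_zero, smul_zero]
      intro L _
      rw [Finsupp.single_eq_of_ne, mul_zero]
      exact fun h => hkn (congrArg Sigma.fst h).symm

theorem transition_surjective : Function.Surjective (transition K) := by
  rw [← LinearMap.range_eq_top, eq_top_iff, ← (basisF K).span_eq, Submodule.span_le]
  rintro _ ⟨⟨n, σ, I⟩, rfl⟩
  exact F_mem_range_transition K σ I

/-- The automorphism `F_{σ,I} ↦ ∑_J c_{IJ} F_{σ,J}`. -/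
noncomputable def transitionEquiv : FQSymCol K ≃ₗ[K] FQSymCol K :=
  LinearEquiv.ofBijective (transition K) ⟨transition_injective K, transition_surjective K⟩

/-- The basis `Z_{σ,J}`. -/
noncomputable def basisZ : Module.Basis ColPerm K (FQSymCol K) :=
  (basisF K).map (transitionEquiv K).symm

theorem transition_basisZ (a : ColPerm) : transition K (basisZ K a) = basisF K a :=
  (transitionEquiv K).apply_symm_apply (basisF K a)

theorem F_eq_sum_basisZ {n : ℕ} (σ : Equiv.Perm (Fin n)) (I : Fin n → ℕ+) :
    F K σ I =
      ∑ J ∈ compsOf n (compWeight I), (setPartCoeff I J : K) • basisZ K ⟨n, σ, J⟩ := by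
  refine transition_injective K ?_
  simp only [transition_F, map_sum, map_smul, transition_basisZ, basisF_apply]

theorem basisZ_unique (Z' : ColPerm → FQSymCol K)
    (h : ∀ (n : ℕ) (σ : Equiv.Perm (Fin n)) (I : Fin n → ℕ+), F K σ I =
      ∑ J ∈ compsOf n (compWeight I), (setPartCoeff I J : K) • Z' ⟨n, σ, J⟩) :
    Z' = basisZ K := by
  have hS : ∀ x, (basisF K).constr K Z' (transition K x) = x := by
    have : ((basisF K).constr K Z').comp (transition K) = LinearMap.id := by
      refine (basisF K).ext ?_
      rintro ⟨n, σ, I⟩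
      rw [LinearMap.comp_apply, basisF_apply, transition_F, LinearMap.id_apply]
      conv_rhs => rw [h]
      simp only [map_sum, map_smul, ← basisF_apply, Module.Basis.constr_basis]
    exact fun x => DFunLike.congr_fun this x
  funext a
  rw [← hS (basisZ K a), transition_basisZ, Module.Basis.constr_basis]

/-- The linear map `Z_{σ,J} ↦ z_{σ,J}`, the fraction being read from right to left. -/
noncomputable def toMouldLinear : FQSymCol K →ₗ[K] RatMould K :=
  (basisZ K).constr K fun a => DirectSum.of (RatFn K) a.1
    (RatFn.zFrac K (Fin.revPerm.trans a.2.1) (a.2.2 ∘ Fin.rev))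

theorem toMouldLinear_basisZ {n : ℕ} (σ : Equiv.Perm (Fin n)) (J : Fin n → ℕ+) :
    toMouldLinear K (basisZ K ⟨n, σ, J⟩) =
      DirectSum.of (RatFn K) n (RatFn.zFrac K (Fin.revPerm.trans σ) (J ∘ Fin.rev)) :=
  Module.Basis.constr_basis _ _ _ _

theorem of_smul (n : ℕ) (r : K) (f : RatFn K n) :
    DirectSum.of (RatFn K) n (r • f) = r • DirectSum.of (RatFn K) n f :=
  (DirectSum.lof K ℕ (RatFn K) n).map_smul r f

theorem toMouldLinear_F {n : ℕ} (σ : Equiv.Perm (Fin n)) (I : Fin n → ℕ+) :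
    toMouldLinear K (F K σ I) = DirectSum.of (RatFn K) n
      (linFormSeries (fun i => RatFn.var K (σ i)) (fun i => (I i : ℕ) - 1)) := by
  rw [F_eq_sum_basisZ, ← RatFn.sum_setPartCoeff_smul_zFrac]
  simp only [map_sum, map_smul, toMouldLinear_basisZ, of_smul]

theorem of_mul_of_eq_mu {m n : ℕ} (f : RatFn K m) (g : RatFn K n) :
    DirectSum.of (RatFn K) m f * DirectSum.of (RatFn K) n g =
      DirectSum.of (RatFn K) (m + n) (RatFn.mu K f g) :=
  DirectSum.of_mul_of f g

theorem toMouldLinear_one : toMouldLinear K 1 = 1 := by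
  change toMouldLinear K (F K (1 : Equiv.Perm (Fin 0)) ![]) = _
  rw [toMouldLinear_F, linFormSeries_zero]
  rfl

theorem toMouldLinear_mul [CharZero K] (x y : FQSymCol K) :
    toMouldLinear K (x * y) = toMouldLinear K x * toMouldLinear K y := by
  induction x using induction_linear with
  | zero => simp
  | add x x' h h' => rw [add_mul, map_add, map_add, h, h', add_mul]
  | smul_F r m σ c =>
  induction y using induction_linear with
  | zero => simp
  | add y y' h h' => rw [mul_add, map_add, map_add, h, h', mul_add]
  | smul_F s n τ d =>
    rw [smul_mul_smul_comm, map_smul, map_smul, map_smul, smul_mul_smul_comm, F_mul_F, basisMul,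
      toMouldLinear_F, toMouldLinear_F, of_mul_of_eq_mu, RatFn.mu_linFormSeries]
    simp only [map_sum, map_smul, toMouldLinear_F, of_smul]

/-- The realization of `FQSym^{(ℕ*)}` by rational moulds. -/
noncomputable def toMould [CharZero K] : FQSymCol K →ₐ[K] RatMould K :=
  AlgHom.ofLinearMap (toMouldLinear K) (toMouldLinear_one K) (toMouldLinear_mul K)

theorem linearIndependent_mould_of {ι : ℕ → Type*} (f : ∀ n, ι n → RatFn K n)
    (hf : ∀ n, LinearIndependent K (f n)) :
    LinearIndependent K fun a : Σ n, ι n => DirectSum.of (RatFn K) a.1 (f a.1 a.2) := by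
  classical
  rw [linearIndependent_iff']
  rintro S g h ⟨n, i⟩ hi
  have hinj : Function.Injective (Sigma.mk n : ι n → Σ n, ι n) := sigma_mk_injective
  refine linearIndependent_iff'.1 (hf n) (S.preimage (Sigma.mk n) hinj.injOn)
    (fun j => g ⟨n, j⟩) ?_ i (Finset.mem_preimage.2 hi)
  have hn := congrArg (DirectSum.component K ℕ (RatFn K) n) h
  rw [map_sum, map_zero, ← Finset.sum_preimage (Sigma.mk n) S hinj.injOn] at hn
  · rw [← hn]
    refine Finset.sum_congr rfl fun j _ => ?_
    rw [map_smul]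
    congr 1
    exact (DirectSum.of_eq_same n (f n j)).symm
  · rintro ⟨k, j⟩ _ hk
    have hkn : k ≠ n := by
      rintro rfl
      exact hk ⟨j, rfl⟩
    rw [map_smul]
    have : DirectSum.component K ℕ (RatFn K) n (DirectSum.of (RatFn K) k (f k j)) = 0 :=
      DirectSum.of_eq_of_ne _ _ _ hkn.symm
    rw [this, smul_zero]

theorem reverse_injective (n : ℕ) : Function.Injective
    fun a : Equiv.Perm (Fin n) × (Fin n → ℕ+) => (Fin.revPerm.trans a.1, a.2 ∘ Fin.rev) := by
  rintro ⟨σ, J⟩ ⟨τ, L⟩ h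
  obtain ⟨h1, h2⟩ := Prod.mk.inj h
  refine Prod.ext (Equiv.ext fun i => ?_) (funext fun i => ?_)
  · simpa using DFunLike.congr_fun h1 (Fin.rev i)
  · simpa using congrFun h2 (Fin.rev i)

theorem linearIndependent_zFrac_reverse [CharZero K] (n : ℕ) :
    LinearIndependent K fun a : Equiv.Perm (Fin n) × (Fin n → ℕ+) =>
      RatFn.zFrac K (Fin.revPerm.trans a.1) (a.2 ∘ Fin.rev) := by
  have h := (RatFn.linearIndependent_zFrac K n).comp
    (fun a : Equiv.Perm (Fin n) × (Fin n → ℕ+) => (Fin.revPerm.trans a.1, a.2 ∘ Fin.rev))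
    (reverse_injective n)
  exact h

theorem toMouldLinear_injective [CharZero K] : Function.Injective (toMouldLinear K) := by
  have hli := linearIndependent_mould_of K
    (fun n (a : Equiv.Perm (Fin n) × (Fin n → ℕ+)) =>
      RatFn.zFrac K (Fin.revPerm.trans a.1) (a.2 ∘ Fin.rev))
    (fun n => linearIndependent_zFrac_reverse K n)
  intro x y hxy
  refine (basisZ K).repr.injective (hli ?_)
  rw [toMouldLinear, Module.Basis.constr_apply, Module.Basis.constr_apply] at hxy
  exact hxy
theorem range_toMould [CharZero K] :
    Subalgebra.toSubmodule (toMould K).range =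
      Submodule.span K {f : RatMould K | ∃ (n : ℕ) (σ : Equiv.Perm (Fin n)) (s : Fin n → ℕ+),
        f = DirectSum.of (RatFn K) n (RatFn.zFrac K σ s)} := by
  have h1 : Subalgebra.toSubmodule (toMould K).range = LinearMap.range (toMouldLinear K) := rfl
  rw [h1, toMouldLinear, Module.Basis.constr_range]
  congr 1
  ext f
  constructor
  · rintro ⟨⟨n, σ, J⟩, rfl⟩
    exact ⟨n, _, _, rfl⟩
  · rintro ⟨n, σ, s, rfl⟩
    refine ⟨⟨n, Fin.revPerm.trans σ, s ∘ Fin.rev⟩, ?_⟩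
    have h2 : Fin.revPerm.trans (Fin.revPerm.trans σ) = σ := by ext i; simp
    have h3 : (s ∘ Fin.rev) ∘ Fin.rev = s := by funext i; simp
    simp only [h2, h3]

theorem basisZ_mul_basisZ [CharZero K] {m n : ℕ} (σ' : Equiv.Perm (Fin m)) (J' : Fin m → ℕ+)
    (σ'' : Equiv.Perm (Fin n)) (J'' : Fin n → ℕ+) :
    basisZ K ⟨m, σ', J'⟩ * basisZ K ⟨n, σ'', J''⟩ =
      ∑ σ : Equiv.Perm (Fin (m + n)), ∑ J ∈ compsOf (m + n) (compWeight J' + compWeight J''),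
        (((shuffle (epsWord 0 σ' J') (epsWord m σ'' J'')).count (epsWord 0 σ J) : ℕ) : K) •
          basisZ K ⟨m + n, σ, J⟩ := by
  refine toMouldLinear_injective K ?_
  rw [toMouldLinear_mul, toMouldLinear_basisZ, toMouldLinear_basisZ, of_mul_of_eq_mu,
    RatFn.mu_zFrac]
  simp only [map_sum, map_smul, toMouldLinear_basisZ, of_smul]

end FQSymCol

theorem mainTheorem1 (K : Type*) [Field K] [CharZero K] :
    -- the generating function of the numbers `c_{IJ}`
    (∀ (n : ℕ) (J : Fin n → ℕ+),
      ∑ I ∈ compsOf n (compWeight J), (setPartCoeff I J : MvPolynomial (Fin n) ℤ) *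
          ∏ s, MvPolynomial.X s ^ ((I s : ℕ) - 1) =
        ∏ s, (∑ t ∈ Finset.Ici s, MvPolynomial.X t) ^ ((J s : ℕ) - 1)) ∧
    -- the matrix `(c_{IJ})` is unitriangular for the lexicographic order
    (∀ (n : ℕ) (I J : Fin n → ℕ+), compWeight I = compWeight J →
      setPartCoeff I I = 1 ∧ (setPartCoeff I J ≠ 0 → toLex I ≤ toLex J)) ∧
    -- there is exactly one family `Z` with `F_{σ,I} = ∑_J c_{IJ} Z_{σ,J}`, and it is a basis
    ∃ Z : Module.Basis ColPerm K (FQSymCol K),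
      (∀ (n : ℕ) (σ : Equiv.Perm (Fin n)) (I : Fin n → ℕ+),
        FQSymCol.F K σ I =
          ∑ J ∈ compsOf n (compWeight I), (setPartCoeff I J : K) • Z ⟨n, σ, J⟩) ∧
      (∀ Z' : ColPerm → FQSymCol K,
        (∀ (n : ℕ) (σ : Equiv.Perm (Fin n)) (I : Fin n → ℕ+),
          FQSymCol.F K σ I =
            ∑ J ∈ compsOf n (compWeight I), (setPartCoeff I J : K) • Z' ⟨n, σ, J⟩) →
        Z' = Z) ∧
      -- the product rule
      (∀ (m n : ℕ) (σ' : Equiv.Perm (Fin m)) (J' : Fin m → ℕ+)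
          (σ'' : Equiv.Perm (Fin n)) (J'' : Fin n → ℕ+),
        Z ⟨m, σ', J'⟩ * Z ⟨n, σ'', J''⟩ =
          ∑ σ : Equiv.Perm (Fin (m + n)),
            ∑ J ∈ compsOf (m + n) (compWeight J' + compWeight J''),
              (((shuffle (epsWord 0 σ' J') (epsWord m σ'' J'')).count
                (epsWord 0 σ J) : ℕ) : K) • Z ⟨m + n, σ, J⟩) ∧
      -- the same product rule for the fractions `z_{σ,J}`, read from right to left
      (∀ (m n : ℕ) (σ' : Equiv.Perm (Fin m)) (J' : Fin m → ℕ+)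
          (σ'' : Equiv.Perm (Fin n)) (J'' : Fin n → ℕ+),
        RatFn.mu K (RatFn.zFrac K (Fin.revPerm.trans σ') (J' ∘ Fin.rev))
            (RatFn.zFrac K (Fin.revPerm.trans σ'') (J'' ∘ Fin.rev)) =
          ∑ σ : Equiv.Perm (Fin (m + n)),
            ∑ J ∈ compsOf (m + n) (compWeight J' + compWeight J''),
              (((shuffle (epsWord 0 σ' J') (epsWord m σ'' J'')).count
                (epsWord 0 σ J) : ℕ) : K) •
                RatFn.zFrac K (Fin.revPerm.trans σ) (J ∘ Fin.rev)) ∧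
      -- the realization by rational moulds
      ∃ Φ : FQSymCol K →ₐ[K] RatMould K,
        Function.Injective Φ ∧
        (∀ (n : ℕ) (σ : Equiv.Perm (Fin n)) (J : Fin n → ℕ+),
          Φ (Z ⟨n, σ, J⟩) =
            DirectSum.of (RatFn K) n (RatFn.zFrac K (Fin.revPerm.trans σ) (J ∘ Fin.rev))) ∧
        Subalgebra.toSubmodule Φ.range =
          Submodule.span K {f : RatMould K | ∃ (n : ℕ) (σ : Equiv.Perm (Fin n))
            (s : Fin n → ℕ+), f = DirectSum.of (RatFn K) n (RatFn.zFrac K σ s)} := by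
  exact ⟨fun n J => sum_setPartCoeff J,
    fun n I J h => ⟨setPartCoeff_self I, toLex_le_of_setPartCoeff_ne_zero h⟩,
    FQSymCol.basisZ K, fun n σ I => FQSymCol.F_eq_sum_basisZ K σ I, FQSymCol.basisZ_unique K,
    fun m n σ' J' σ'' J'' => FQSymCol.basisZ_mul_basisZ K σ' J' σ'' J'',
    fun m n σ' J' σ'' J'' => RatFn.mu_zFrac K σ' J' σ'' J'',
    FQSymCol.toMould K, FQSymCol.toMouldLinear_injective K,
    fun n σ J => FQSymCol.toMouldLinear_basisZ K σ J, FQSymCol.range_toMould K⟩
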